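/- \textbf{Setting.} Let $\{Z_t\}_{t\ge 0}$ be a stationary, irreducible, time-homogeneous Markov chain on a finite set $\mathsf Z$ with transition matrix $P$, and let $\{\epsilon_t\},\{\zeta_t\},\{\eta_t\}$ be i.i.d. processes, with $\{Z_t\},\{\epsilon_t\},\{\zeta_t\},\{\eta_t\}$ mutually independent. Put $\beta_0=1$ and, for $t\ge 1$, $\beta_t=\beta(Z_t,\epsilon_t)$, $R_t=R(Z_t,\zeta_t)$, $Y_t=Y(Z_t,\eta_t)$, where $\beta,R,Y$ are measurable functions with values in $[0,\infty)$. Write $\mathbb E_z=\mathbb E[\,\cdot\mid Z_0=z]$ and let hats denote the values at $t=1$. The utility function $u:[0,\infty)\to\{-\infty\}\cup\mathbb R$ is real valued and twice differentiable on $(0,\infty)$ with $u'>0$, $u''<0$ there, $u(0)\le u(c)$ for all $c>0$, $u'(c)\to\infty$ as $c\downarrow 0$, and $u'(c)<1$ for all large $c$; set $u'(0)=\infty$ and $0\cdot\infty=0$. Assume that $\mathbb E\prod_{t=1}^n\beta_t$ and $\mathbb E\prod_{t=1}^n\beta_tR_t$ are finite for every $n$, and that $$G_\beta=\lim_n\Big(\mathbb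 E\prod_{t=1}^n\beta_t\Big)^{1/n}<1,\qquad G_{\beta R}=\lim_n\Big(\mathbb E\prod_{t=1}^n\beta_tR_t\Big)^{1/n}<1,\qquad \mathbb E\,Y_1<\infty,\qquad \mathbb E\,u'(Y_1)<\infty .$$ A feasible policy is a measurable function $c$ on $(0,\infty)\times\mathsf Z$ with $0\le c(a,z)\le a$. It generates the asset path $a_0=a$, $a_{t+1}=R_{t+1}(a_t-c(a_t,Z_t))+Y_{t+1}$ and has the lifetime value $V_c(a,z)=\mathbb E_{z}\sum_{t\ge0}\beta_0\cdots\beta_t\,u(c(a_t,Z_t))$; it is optimal if $V_d\le V_c$ on $(0,\infty)\times\mathsf Z$ for every feasible policy $d$. Let $\mathscr C$ be the set of continuous $c:(0,\infty)\times\mathsf Z\to\mathbb R$ that are nondecreasing in $a$ and satisfy $0<c(a,z)\le a$ and $\sup_{a,z}|u'(c(a,z))-u'(a)|<\infty$. For $c\in\mathscr C$, the time iteration operator $T$ maps $c$ to the function $Tc$ whose value at $(a,z)$ is the $\xi\in(0,a]$ that solves $$u'(\xi)=\max\big\{\mathbb E_z\,\hat\beta\hat R\,u'\big(c(\hat R(a-\xi)+\hat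 Y,\hat Z)\big),\;u'(a)\big\}.$$ \textbf{Proposition (Linear lower bound on consumption).} There is a $c^*\in\mathscr C$ (the optimal consumption function) that is both the unique fixed point of $T$ in $\mathscr C$ and the unique optimal policy in $\mathscr C$, and it has the following properties. (i) If $0\le\bar s<1$ and $$\mathbb E_z\,\hat\beta\hat R\,u'(\hat R\,\bar s\,a)\le u'(a)\quad\text{for all }(a,z)\in(0,\infty)\times\mathsf Z,\tag{1}$$ then $c^*(a,z)\ge(1-\bar s)a$ for all $(a,z)\in(0,\infty)\times\mathsf Z$. (ii) The conclusion of (i) still holds if (1) is replaced by the weaker condition $\mathbb E_z\,\hat\beta\hat R\,u'[\hat R\,\bar s\,a+(1-\bar s)\hat Y]\le u'(a)$ for all $(a,z)\in(0,\infty)\times\mathsf Z$. (iii) Suppose that utility is CRRA: for some $\gamma>0$ and all $c>0$, $u(c)=c^{1-\gamma}/(1-\gamma)$ if $\gamma\ne1$ and $u(c)=\log c$ if $\gamma=1$. If $\bar s:=\big(\max_{z\in\mathsf Z}\mathbb E_z\,\hat\beta\hat R^{\,1-\gamma}\big)^{1/\gamma}<1$ (with $0^{1-\gamma}=\infty$ for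 $\gamma>1$ and $0^0=1$), then (1) holds for this $\bar s$, and hence $c^*(a,z)\ge(1-\bar s)a$ for all $(a,z)\in(0,\infty)\times\mathsf Z$. -/

import Mathlib

open MeasureTheory ProbabilityTheory Filter Topology
open scoped ENNReal NNReal

namespace IncomeFluctuation

noncomputable section

/-! ### Utility -/

/-- The real-valued version of a utility function `u : [0, ∞) → {-∞} ∪ ℝ`, as a function on `ℝ`
(only its values on `(0, ∞)`, where `u` is finite, matter). -/
def realUtility (u : ℝ≥0 → EReal) (x : ℝ) : ℝ := (u x.toNNReal).toReal

/-- The standing conditions on the utility function. Twice differentiability, `u' > 0` and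
`u'' < 0` are required on `(0, ∞)`; the value at `0` may be `-∞` and is only required not to
exceed the other values. -/
structure IsUtility (u : ℝ≥0 → EReal) : Prop where
  finite : ∀ x : ℝ≥0, 0 < x → u x ≠ ⊥ ∧ u x ≠ ⊤
  zero_le : ∀ x : ℝ≥0, 0 < x → u 0 ≤ u x
  differentiable : ∀ x : ℝ, 0 < x → DifferentiableAt ℝ (realUtility u) x
  twice_differentiable : ∀ x : ℝ, 0 < x → DifferentiableAt ℝ (deriv (realUtility u)) x
  deriv_pos : ∀ x : ℝ, 0 < x → 0 < deriv (realUtility u) x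
  deriv2_neg : ∀ x : ℝ, 0 < x → deriv (deriv (realUtility u)) x < 0
  inada_zero : Tendsto (deriv (realUtility u)) (𝓝[>] 0) atTop
  eventually_lt_one : ∀ᶠ x in atTop, deriv (realUtility u) x < 1

/-- Marginal utility `u'` as a function `[0, ∞) → [0, ∞]`, with `u'(0) = ∞`. -/
def marginal (u : ℝ≥0 → EReal) (x : ℝ≥0) : ℝ≥0∞ :=
  if x = 0 then ⊤ else ENNReal.ofReal (deriv (realUtility u) x)

/-- `u` is the utility function with constant relative risk aversion `γ` (on `(0, ∞)`). -/
def IsCRRA (u : ℝ≥0 → EReal) (γ : ℝ) : Prop :=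
  ∀ x : ℝ≥0, 0 < x →
    u x = ((if γ = 1 then Real.log x else (x : ℝ) ^ (1 - γ) / (1 - γ) : ℝ) : EReal)

/-! ### Primitives and shocks -/

/-- The primitives of the income fluctuation problem: the transition matrix `P` of the exogenous
state, the discount factor `β(z, ε)`, the gross return `R(z, ζ)`, the non-financial income
`Y(z, η)` and the utility function `u`. -/
structure Model (S E F H : Type*) where
  P : Matrix S S ℝ
  β : S × E → ℝ≥0
  R : S × F → ℝ≥0
  Y : S × H → ℝ≥0
  u : ℝ≥0 → EReal

/-- The conditions on the primitives that are in force throughout. -/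
structure Model.IsRegular {S E F H : Type*} [Fintype S] [MeasurableSpace S] [MeasurableSpace E]
    [MeasurableSpace F] [MeasurableSpace H] (m : Model S E F H) : Prop where
  row_sum : ∀ z, ∑ z', m.P z z' = 1
  irreducible : m.P.IsIrreducible
  measurable_β : Measurable m.β
  measurable_R : Measurable m.R
  measurable_Y : Measurable m.Y
  utility : IsUtility m.u

/-- The exogenous state process `Z` and the innovation processes `ε`, `ζ`, `η` on `Ω`. -/
structure Shocks (Ω S E F H : Type*) where
  Z : ℕ → Ω → S
  ε : ℕ → Ω → E
  ζ : ℕ → Ω → F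
  η : ℕ → Ω → H

/-- Under `μ`, the process `Z` is a stationary time-homogeneous Markov chain with transition
matrix `P`, each innovation process is i.i.d., and the four processes are independent. -/
structure Shocks.IsDriving {Ω S E F H : Type*} [MeasurableSpace Ω] [MeasurableSpace S]
    [MeasurableSpace E] [MeasurableSpace F] [MeasurableSpace H]
    (s : Shocks Ω S E F H) (P : Matrix S S ℝ) (μ : Measure Ω) : Prop where
  measurable_Z : ∀ t, Measurable (s.Z t)
  measurable_ε : ∀ t, Measurable (s.ε t)
  measurable_ζ : ∀ t, Measurable (s.ζ t)
  measurable_η : ∀ t, Measurable (s.η t)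
  markov : ∀ (n : ℕ) (z : ℕ → S),
    μ.real {ω | ∀ t ≤ n, s.Z t ω = z t} =
      μ.real {ω | s.Z 0 ω = z 0} * ∏ t ∈ Finset.range n, P (z t) (z (t + 1))
  stationary : ∀ z, μ.real {ω | s.Z 1 ω = z} = μ.real {ω | s.Z 0 ω = z}
  iIndep_ε : iIndepFun s.ε μ
  iIndep_ζ : iIndepFun s.ζ μ
  iIndep_η : iIndepFun s.η μ
  ident_ε : ∀ t, IdentDistrib (s.ε t) (s.ε 0) μ μ
  ident_ζ : ∀ t, IdentDistrib (s.ζ t) (s.ζ 0) μ μ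
  ident_η : ∀ t, IdentDistrib (s.η t) (s.η 0) μ μ
  indep_Z : IndepFun (fun ω t => s.Z t ω) (fun ω t => (s.ε t ω, s.ζ t ω, s.η t ω)) μ
  indep_ε : IndepFun (fun ω t => s.ε t ω) (fun ω t => (s.ζ t ω, s.η t ω)) μ
  indep_ζ : IndepFun (fun ω t => s.ζ t ω) (fun ω t => s.η t ω) μ

section Problem

variable {Ω S E F H : Type*} (m : Model S E F H) (s : Shocks Ω S E F H)

/-- The discount factor `β_t = β(Z_t, ε_t)` (used for `t ≥ 1`). -/
def betaAt (t : ℕ) (ω : Ω) : ℝ≥0 := m.β (s.Z t ω, s.ε t ω)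

/-- The gross return `R_t = R(Z_t, ζ_t)`. -/
def returnAt (t : ℕ) (ω : Ω) : ℝ≥0 := m.R (s.Z t ω, s.ζ t ω)

/-- The non-financial income `Y_t = Y(Z_t, η_t)`. -/
def incomeAt (t : ℕ) (ω : Ω) : ℝ≥0 := m.Y (s.Z t ω, s.η t ω)

/-- The cumulative discount factor `β_0 β_1 ⋯ β_t`, where `β_0 = 1`. -/
def discount (t : ℕ) (ω : Ω) : ℝ≥0 := ∏ i ∈ Finset.Icc 1 t, betaAt m s i ω

/-- The asset path generated by the policy `c` from initial wealth `a`: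
`a_{t+1} = R_{t+1} (a_t - c(a_t, Z_t)) + Y_{t+1}`. -/
def assetPath (c : ℝ≥0 → S → ℝ≥0) (a : ℝ≥0) : ℕ → Ω → ℝ≥0
  | 0, _ => a
  | t + 1, ω =>
    returnAt m s (t + 1) ω * (assetPath c a t ω - c (assetPath c a t ω) (s.Z t ω))
      + incomeAt m s (t + 1) ω

variable [MeasurableSpace Ω] (μ : Measure Ω)

/-- `ℙ_z`, the probability conditional on `Z_0 = z`. -/
def condLaw (z : S) : Measure Ω := μ[|{ω | s.Z 0 ω = z}]

/-- The nonnegative process `φ_1, φ_2, …` has finite expected products and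
`lim_n (𝔼 φ_1 ⋯ φ_n)^(1/n)` exists and is less than one. -/
def GrowthRateLTOne (φ : ℕ → Ω → ℝ≥0) : Prop :=
  (∀ n : ℕ, ∫⁻ ω, ((∏ t ∈ Finset.Icc 1 n, φ t ω : ℝ≥0) : ℝ≥0∞) ∂μ < ⊤) ∧
  ∃ G : ℝ≥0∞, G < 1 ∧
    Tendsto (fun n : ℕ =>
      (∫⁻ ω, ((∏ t ∈ Finset.Icc 1 n, φ t ω : ℝ≥0) : ℝ≥0∞) ∂μ) ^ (1 / (n : ℝ))) atTop (𝓝 G)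

/-- The standing assumptions: `G_β < 1`, `G_{βR} < 1`, `𝔼 Y < ∞` and `𝔼 u'(Y) < ∞`. -/
structure KeyConditions : Prop where
  growth_β : GrowthRateLTOne μ (betaAt m s)
  growth_βR : GrowthRateLTOne μ (fun t ω => betaAt m s t ω * returnAt m s t ω)
  income : ∫⁻ ω, (incomeAt m s 1 ω : ℝ≥0∞) ∂μ < ⊤
  marginal_income : ∫⁻ ω, marginal m.u (incomeAt m s 1 ω) ∂μ < ⊤

/-! ### Policies and optimality

A policy is given on `[0, ∞) × S`. The constraint `c(a, z) ≤ a` forces `c(0, z) = 0`, so such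
functions correspond one to one to policies on `(0, ∞) × S`. -/

/-- Feasible policies: measurable with `0 ≤ c(a, z) ≤ a`. -/
def IsFeasible [MeasurableSpace S] (c : ℝ≥0 → S → ℝ≥0) : Prop :=
  Measurable (Function.uncurry c) ∧ ∀ a z, c a z ≤ a

/-- The lifetime value `V_c(a, z) = 𝔼_{a,z} ∑_t β_0 ⋯ β_t u(c(a_t, Z_t))` in `[-∞, ∞]`, as the
expectation of the sum of the positive parts minus that of the sum of the negative parts. -/
def lifetimeValue (c : ℝ≥0 → S → ℝ≥0) (a : ℝ≥0) (z : S) : EReal :=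
  ((∫⁻ ω, ∑' t, (discount m s t ω : ℝ≥0∞) *
      (m.u (c (assetPath m s c a t ω) (s.Z t ω))).toENNReal ∂(condLaw s μ z) : ℝ≥0∞) : EReal)
  - ((∫⁻ ω, ∑' t, (discount m s t ω : ℝ≥0∞) *
      (-m.u (c (assetPath m s c a t ω) (s.Z t ω))).toENNReal ∂(condLaw s μ z) : ℝ≥0∞) : EReal)

/-- A feasible policy is optimal if its lifetime value is the largest among all feasible policies
at each `(a, z)` with `a > 0`. -/
def IsOptimal [MeasurableSpace S] (c : ℝ≥0 → S → ℝ≥0) : Prop :=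
  IsFeasible c ∧ ∀ d : ℝ≥0 → S → ℝ≥0, IsFeasible d → ∀ a : ℝ≥0, 0 < a → ∀ z,
    lifetimeValue m s μ d a z ≤ lifetimeValue m s μ c a z

/-- The class `𝒞` of candidate policies: continuous and increasing in wealth on `(0, ∞)`, with
`0 < c(a, z) ≤ a` and `sup |u'(c(a, z)) - u'(a)| < ∞`. -/
structure IsCandidate (c : ℝ≥0 → S → ℝ≥0) : Prop where
  continuousOn : ∀ z, ContinuousOn (fun a => c a z) (Set.Ioi 0)
  monotoneOn : ∀ z, MonotoneOn (fun a => c a z) (Set.Ioi 0)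
  pos : ∀ a z, 0 < a → 0 < c a z
  le : ∀ a z, c a z ≤ a
  bounded : ∃ M : ℝ, ∀ (a : ℝ≥0) (z : S), 0 < a →
    |deriv (realUtility m.u) (c a z) - deriv (realUtility m.u) a| ≤ M

/-- `ψ_c(ξ, a, z) = max {𝔼_z β̂ R̂ u'(c(R̂ (a - ξ) + Ŷ, Ẑ)), u'(a)}`. -/
def eulerRHS (c : ℝ≥0 → S → ℝ≥0) (ξ a : ℝ≥0) (z : S) : ℝ≥0∞ :=
  max (∫⁻ ω, (betaAt m s 1 ω : ℝ≥0∞) * returnAt m s 1 ω *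
      marginal m.u (c (returnAt m s 1 ω * (a - ξ) + incomeAt m s 1 ω) (s.Z 1 ω))
      ∂(condLaw s μ z))
    (marginal m.u a)

/-- `d = T c` for the time iteration operator `T`: for all `a > 0` and `z`, the number
`ξ = d(a, z)` is the point of `(0, a]` that solves `u'(ξ) = ψ_c(ξ, a, z)`. -/
def IsTimeIterate (c d : ℝ≥0 → S → ℝ≥0) : Prop :=
  ∀ (a : ℝ≥0) (z : S), 0 < a →
    0 < d a z ∧ d a z ≤ a ∧ marginal m.u (d a z) = eulerRHS m s μ c (d a z) a z

/-- `c` is the optimal consumption function: a member of `𝒞` that is the unique fixed point of `T`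
in `𝒞` and the unique optimal policy in `𝒞`. -/
def IsOptimalConsumption [MeasurableSpace S] (c : ℝ≥0 → S → ℝ≥0) : Prop :=
  IsCandidate m c ∧
  (∀ d, IsCandidate m d → (IsTimeIterate m s μ d d ↔ d = c)) ∧
  (∀ d, IsCandidate m d → (IsOptimal m s μ d ↔ d = c))

/-! ### Conditions for the linear lower bound -/

/-- `𝔼_z β̂ R̂ u'(R̂ s̄ a) ≤ u'(a)` for all `a > 0` and `z`, with `0 · ∞ = 0`. -/
def SavingsBound (sbar : ℝ≥0) : Prop :=
  ∀ (a : ℝ≥0) (z : S), 0 < a →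
    ∫⁻ ω, (betaAt m s 1 ω : ℝ≥0∞) * returnAt m s 1 ω *
      marginal m.u (returnAt m s 1 ω * sbar * a) ∂(condLaw s μ z) ≤ marginal m.u a

/-- `𝔼_z β̂ R̂ u'(R̂ s̄ a + (1 - s̄) Ŷ) ≤ u'(a)` for all `a > 0` and `z`. -/
def WeakSavingsBound (sbar : ℝ≥0) : Prop :=
  ∀ (a : ℝ≥0) (z : S), 0 < a →
    ∫⁻ ω, (betaAt m s 1 ω : ℝ≥0∞) * returnAt m s 1 ω *
      marginal m.u (returnAt m s 1 ω * sbar * a + (1 - sbar) * incomeAt m s 1 ω)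
      ∂(condLaw s μ z) ≤ marginal m.u a

/-- `(max_z 𝔼_z β̂ R̂^(1-γ))^(1/γ)` in `[0, ∞]`. -/
def crraSavingsRate (γ : ℝ) : ℝ≥0∞ :=
  (⨆ z : S, ∫⁻ ω, (betaAt m s 1 ω : ℝ≥0∞) * (returnAt m s 1 ω : ℝ≥0∞) ^ (1 - γ)
    ∂(condLaw s μ z)) ^ (1 / γ)

end Problem

end

end IncomeFluctuation

/-! Existence. Start time iteration from the policy of consuming everything. An iterate lowered by
one step stays lowered, because marginal utility decreases and saving more lowers the expected
marginal value of savings, so the iterates decrease pointwise. They stay in a class where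
consumption and savings are both nondecreasing in wealth (hence consumption is 1-Lipschitz) and
u'(c(a,z)) ≤ u'(a) + h(z). Here h = b + K h with b(z) = 𝔼_z β̂R̂u'(Ŷ) and (K h)(z) = 𝔼_z β̂R̂h(Ẑ);
the Neumann series for h converges because G_{βR} < 1 and the chain is irreducible
(`Shocks.IsDriving.resolvent_one_ne_top`). The same h gives an integrable dominating function, so
the limit is a fixed point (`exists_isEulerIterate_self`).

Optimality and uniqueness. For a candidate satisfying the Euler equation put q_t = β_0⋯β_t u'(c_t).
Concavity gives u(d_t) - u(c_t) ≤ u'(c_t)(d_t - c_t). The Euler inequality, which is an equality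
where savings are positive, makes the budget constraints telescope: Σ 𝔼 q_t d_t ≤ Σ 𝔼 q_t c_t + 𝔼
q_T(savings of c at T) (`sum_shadowPrice_le`). The last term vanishes because Σ 𝔼 q_t a_t < ∞.
Strict concavity leaves a positive gap wherever the first choices differ
(`IsEulerPolicy.discountedSum_le`), so every fixed point among the candidates is optimal and every
optimal candidate equals the fixed point. All sums are kept in [0,∞], with positive and negative
parts of utility on opposite sides, so that nothing has to be subtracted before finiteness is known.

Linear bound. Under the weak condition, time iteration preserves c(a,z) ≥ (1 - s̄)a
(`IsEulerIterate.linear_le`). The starting policy satisfies this bound, and it survives the limit.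
Condition (1) implies the weak condition by monotonicity of u', and under CRRA it reduces to a
computation with powers. -/

namespace IncomeFluctuation

set_option linter.unusedSectionVars false

/-! ### Marginal utility and tangent inequalities in [0,∞]. -/

section Utility

variable {u : ℝ≥0 → EReal}

theorem IsUtility.strictAntiOn_deriv (hu : IsUtility u) :
    StrictAntiOn (deriv (realUtility u)) (Set.Ioi 0) := by
  apply strictAntiOn_of_deriv_neg (convex_Ioi 0)
  · exact fun x hx => (hu.twice_differentiable x hx).continuousAt.continuousWithinAt
  · intro x hx
    rw [interior_Ioi] at hx
    exact hu.deriv2_neg x hx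

@[simp] theorem marginal_zero : marginal u 0 = ⊤ := by simp [marginal]

theorem marginal_of_pos {x : ℝ≥0} (hx : 0 < x) :
    marginal u x = ENNReal.ofReal (deriv (realUtility u) x) := by
  simp [marginal, hx.ne']

theorem marginal_ne_top {x : ℝ≥0} (hx : 0 < x) : marginal u x ≠ ⊤ := by
  simp [marginal_of_pos hx]

theorem pos_of_marginal_ne_top {x : ℝ≥0} (hx : marginal u x ≠ ⊤) : 0 < x := by
  rw [pos_iff_ne_zero]
  rintro rfl
  simp at hx

theorem IsUtility.strictAnti_marginal (hu : IsUtility u) : StrictAnti (marginal u) := by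
  intro x y hxy
  have hy : 0 < y := lt_of_le_of_lt (_root_.zero_le : 0 ≤ x) hxy
  rcases eq_or_lt_of_le (_root_.zero_le : 0 ≤ x) with rfl | hx
  · rw [marginal_zero]
    exact (marginal_ne_top hy).lt_top
  · rw [marginal_of_pos hx, marginal_of_pos hy]
    apply (ENNReal.ofReal_lt_ofReal_iff (hu.deriv_pos _ (by exact_mod_cast hx))).2
    exact hu.strictAntiOn_deriv (by exact_mod_cast hx) (by exact_mod_cast hy) (by exact_mod_cast hxy)

/-- At 0, where the value is ∞, this is the Inada condition; elsewhere it is twice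
differentiability. -/
theorem IsUtility.continuous_marginal (hu : IsUtility u) : Continuous (marginal u) := by
  rw [continuous_iff_continuousAt]
  intro x
  rcases eq_or_lt_of_le (_root_.zero_le : 0 ≤ x) with rfl | hx
  · rw [ContinuousAt, marginal_zero, ENNReal.tendsto_nhds_top_iff_nnreal]
    intro r
    have h := (hu.inada_zero.eventually (eventually_gt_atTop (r : ℝ)))
    rw [eventually_nhdsWithin_iff] at h
    have h2 : Tendsto (fun y : ℝ≥0 => (y : ℝ)) (𝓝 0) (𝓝 0) := by
      simpa using (NNReal.continuous_coe.tendsto 0)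
    filter_upwards [h2.eventually h] with y hy
    rcases eq_or_lt_of_le (_root_.zero_le : 0 ≤ y) with rfl | hy0
    · simp
    · rw [marginal_of_pos hy0, ← ENNReal.ofReal_coe_nnreal]
      have := hy (by exact_mod_cast hy0)
      exact (ENNReal.ofReal_lt_ofReal_iff (lt_of_le_of_lt r.2 this)).2 this
  · have h : (fun y : ℝ≥0 => ENNReal.ofReal (deriv (realUtility u) y)) =ᶠ[𝓝 x] marginal u := by
      filter_upwards [lt_mem_nhds hx] with y hy
      rw [marginal_of_pos hy]
    refine ContinuousAt.congr ?_ h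
    refine ENNReal.continuous_ofReal.continuousAt.comp ?_
    exact (hu.twice_differentiable x (by exact_mod_cast hx)).continuousAt.comp
      NNReal.continuous_coe.continuousAt

theorem IsUtility.measurable_marginal (hu : IsUtility u) : Measurable (marginal u) :=
  hu.continuous_marginal.measurable

theorem IsUtility.coe_realUtility (hu : IsUtility u) {x : ℝ≥0} (hx : 0 < x) :
    ((realUtility u x : ℝ) : EReal) = u x := by
  rw [realUtility, Real.toNNReal_coe]
  exact EReal.coe_toReal (hu.finite x hx).2 (hu.finite x hx).1

theorem IsUtility.lt_tangent (hu : IsUtility u) {x y : ℝ} (hx : 0 < x) (hy : 0 < y) (hxy : x ≠ y) :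
    realUtility u y < realUtility u x + deriv (realUtility u) x * (y - x) := by
  have hd : DifferentiableOn ℝ (realUtility u) (Set.Ioi 0) := fun t ht =>
    (hu.differentiable t ht).differentiableWithinAt
  rcases lt_or_gt_of_ne hxy with h | h
  · obtain ⟨t, ht, he⟩ := exists_deriv_eq_slope (realUtility u) h
      (hd.continuousOn.mono fun t ht => lt_of_lt_of_le hx ht.1)
      (hd.mono fun t ht => lt_trans hx ht.1)
    have := hu.strictAntiOn_deriv hx (lt_trans hx ht.1) ht.1
    rw [he, div_lt_iff₀ (by linarith)] at this
    linarith
  · obtain ⟨t, ht, he⟩ := exists_deriv_eq_slope (realUtility u) h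
      (hd.continuousOn.mono fun t ht => lt_of_lt_of_le hy ht.1)
      (hd.mono fun t ht => lt_trans hy ht.1)
    have := hu.strictAntiOn_deriv (lt_trans hy ht.1) hx ht.2
    rw [he, lt_div_iff₀ (by linarith)] at this
    nlinarith

theorem IsUtility.le_tangent (hu : IsUtility u) {x y : ℝ} (hx : 0 < x) (hy : 0 < y) :
    realUtility u y ≤ realUtility u x + deriv (realUtility u) x * (y - x) := by
  rcases eq_or_ne x y with rfl | h
  · simp
  · exact (hu.lt_tangent hx hy h).le

/-- At zero, if the utility is finite there, the tangent inequality is strict. -/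
theorem IsUtility.lt_tangent_zero (hu : IsUtility u) {x : ℝ} (hx : 0 < x) {v : ℝ}
    (hv : u 0 = v) : v < realUtility u x + deriv (realUtility u) x * (0 - x) := by
  have h1 : v ≤ realUtility u (x / 2) := by
    have := hu.zero_le (x / 2).toNNReal (by simpa using hx)
    rw [hv, ← hu.coe_realUtility (by simpa using hx)] at this
    rw [Real.coe_toNNReal _ (by positivity)] at this
    exact_mod_cast this
  -- The utility may jump at 0, so only u(0) ≤ u(t) is available. The tangent at x/2 bounds u(t),
  -- and t → 0 bounds u(0). Using x/2 rather than x is what leaves room for a strict inequality.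
  have key : ∀ t : ℝ, 0 < t → v ≤ realUtility u (x / 2) + deriv (realUtility u) (x / 2) * (t - x / 2) := by
    intro t ht
    have h2 := hu.le_tangent (half_pos hx) ht
    have := hu.zero_le t.toNNReal (by simpa using ht)
    rw [hv, ← hu.coe_realUtility (by simpa using ht), Real.coe_toNNReal _ ht.le] at this
    have h3 : v ≤ realUtility u t := by exact_mod_cast this
    linarith
  have h3 : v ≤ realUtility u (x / 2) + deriv (realUtility u) (x / 2) * (0 - x / 2) := by
    have hc : Continuous fun t : ℝ =>
      realUtility u (x / 2) + deriv (realUtility u) (x / 2) * (t - x / 2) := by fun_prop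
    refine ge_of_tendsto (hc.continuousWithinAt (s := Set.Ioi 0) (x := 0)) ?_
    filter_upwards [self_mem_nhdsWithin] with t ht using key t ht
  have h4 := hu.lt_tangent hx (half_pos hx) (by linarith)
  have h5 := hu.strictAntiOn_deriv (half_pos hx : x / 2 ∈ Set.Ioi 0) hx (by linarith)
  nlinarith

/-- Writing each real as positive part minus negative part and moving every term to the side where
its sign is positive turns a real equation into one in [0,∞] without subtraction. -/
theorem ofReal_add_ofReal_neg_eq {a b p q : ℝ} (hp : 0 ≤ p) (hq : 0 ≤ q) (h : b + p = a + q) :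
    ENNReal.ofReal b + ENNReal.ofReal (-a) + ENNReal.ofReal p =
      ENNReal.ofReal a + ENNReal.ofReal (-b) + ENNReal.ofReal q := by
  have hm : ∀ t : ℝ, ENNReal.ofReal t = ENNReal.ofReal (max t 0) := fun t => by
    rcases le_total t 0 with ht | ht
    · rw [max_eq_right ht, ENNReal.ofReal_of_nonpos ht, ENNReal.ofReal_zero]
    · rw [max_eq_left ht]
  have ha : 0 ≤ max a 0 := le_max_right _ _
  have hb : 0 ≤ max b 0 := le_max_right _ _
  have ha' : 0 ≤ max (-a) 0 := le_max_right _ _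
  have hb' : 0 ≤ max (-b) 0 := le_max_right _ _
  rw [hm b, hm (-a), hm a, hm (-b), ← ENNReal.ofReal_add hb ha',
    ← ENNReal.ofReal_add (add_nonneg hb ha') hp, ← ENNReal.ofReal_add ha hb',
    ← ENNReal.ofReal_add (add_nonneg ha hb') hq]
  have h1 : max a 0 - max (-a) 0 = a := by
    rcases le_total a 0 with h | h <;> simp [h]
  have h2 : max b 0 - max (-b) 0 = b := by
    rcases le_total b 0 with h | h <;> simp [h]
  congr 1
  linarith

theorem IsUtility.ne_top (hu : IsUtility u) (x : ℝ≥0) : u x ≠ ⊤ := by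
  rcases eq_or_lt_of_le (_root_.zero_le : 0 ≤ x) with rfl | hx
  · exact ne_top_of_le_ne_top (hu.finite 1 one_pos).2 (hu.zero_le 1 one_pos)
  · exact (hu.finite x hx).2

/-- The tangent inequality `u y + u'(x) x ≤ u x + u'(x) y`, strict for `x ≠ y`, written with
positive and negative parts. -/
theorem IsUtility.ennreal_tangent (hu : IsUtility u) {x : ℝ≥0} (hx : 0 < x) (y : ℝ≥0) :
    ∃ δ : ℝ≥0∞, (x ≠ y → δ ≠ 0) ∧
      (u y).toENNReal + (-u x).toENNReal + marginal u x * x + δ ≤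
        (u x).toENNReal + (-u y).toENNReal + marginal u x * y := by
  by_cases hb : u y = ⊥
  -- Here the negative part of u(y) is ∞, so the right side is ∞ and any nonzero gap will do.
  · exact ⟨1, by simp, by simp [hb]⟩
  obtain ⟨v, hv⟩ : ∃ v : ℝ, u y = v := ⟨_, (EReal.coe_toReal (hu.ne_top y) hb).symm⟩
  have hx' : (0 : ℝ) < x := by exact_mod_cast hx
  have hD := hu.deriv_pos x hx'
  have hlt : (x : ℝ) ≠ y → v < realUtility u x + deriv (realUtility u) x * (y - x) := by
    intro hxy
    rcases eq_or_lt_of_le (_root_.zero_le : 0 ≤ y) with rfl | hy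
    · exact hu.lt_tangent_zero hx' hv
    · rw [← hu.coe_realUtility hy] at hv
      rw [← EReal.coe_eq_coe_iff.1 hv]
      exact hu.lt_tangent hx' (by exact_mod_cast hy) hxy
  have hle : v ≤ realUtility u x + deriv (realUtility u) x * (y - x) := by
    by_cases hxy : x = y
    · subst hxy
      rw [← hu.coe_realUtility hx] at hv
      simp [EReal.coe_eq_coe_iff.1 hv]
    · exact (hlt (by exact_mod_cast hxy)).le
  set D := deriv (realUtility u) x
  refine ⟨ENNReal.ofReal (realUtility u x + D * (y - x) - v), fun hxy => ?_, ?_⟩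
  · have := hlt (by exact_mod_cast hxy)
    simpa using this
  · rw [hv, ← hu.coe_realUtility hx, marginal_of_pos hx, ← EReal.coe_neg, ← EReal.coe_neg]
    simp only [EReal.real_coe_toENNReal]
    rw [← ENNReal.ofReal_coe_nnreal, ← ENNReal.ofReal_coe_nnreal, ← ENNReal.ofReal_mul hD.le,
      ← ENNReal.ofReal_mul hD.le]
    have hs : 0 ≤ realUtility u x + D * (y - x) - v := by linarith
    rw [add_assoc, ← ENNReal.ofReal_add (by positivity) hs]
    exact (ofReal_add_ofReal_neg_eq (add_nonneg (by positivity) hs) (by positivity)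
      (by ring)).le

theorem IsUtility.toENNReal_le (hu : IsUtility u) (x : ℝ≥0) :
    (u x).toENNReal ≤ (u 1).toENNReal + marginal u 1 * x + (-u x).toENNReal := by
  obtain ⟨δ, -, h⟩ := hu.ennreal_tangent one_pos x
  calc (u x).toENNReal ≤ _ := by
        rw [add_assoc, add_assoc]; exact le_self_add
    _ ≤ _ := h
    _ = _ := by ring

theorem toENNReal_eq_zero_or (v : EReal) : v.toENNReal = 0 ∨ (-v).toENNReal = 0 := by
  rcases le_total v 0 with h | h
  · exact .inl (EReal.toENNReal_of_nonpos h)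
  · exact .inr (EReal.toENNReal_of_nonpos (by simpa using h))

/-- The tangent at 1 bounds gains linearly in consumption, so summability of discounted wealth makes
the gains of every feasible policy finite. -/
theorem IsUtility.toENNReal_le_linear (hu : IsUtility u) (x : ℝ≥0) :
    (u x).toENNReal ≤ (u 1).toENNReal + marginal u 1 * x := by
  rcases toENNReal_eq_zero_or (u x) with h | h
  · simp [h]
  · simpa [h] using hu.toENNReal_le x

/-- This is the tangent at x evaluated at 1. It reduces finiteness of losses to summability of
discounted marginal utility. -/
theorem IsUtility.toENNReal_neg_le_marginal (hu : IsUtility u) (x : ℝ≥0) :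
    (-u x).toENNReal ≤ (-u 1).toENNReal + marginal u x := by
  rcases eq_or_lt_of_le (_root_.zero_le : 0 ≤ x) with rfl | hx
  · simp
  rcases toENNReal_eq_zero_or (u x) with h | h
  · obtain ⟨δ, -, h'⟩ := hu.ennreal_tangent hx 1
    rw [h, zero_add, ENNReal.coe_one, mul_one] at h'
    refine le_trans ?_ h'
    rw [add_assoc, add_assoc, add_left_comm]
    exact le_self_add
  · simp [h]

/-- Splitting at x = 1 replaces a product by a sum whose two terms are controlled separately, by
income's marginal utility and by wealth. -/
theorem IsUtility.marginal_mul_self_le (hu : IsUtility u) (x : ℝ≥0) :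
    marginal u x * x ≤ marginal u x + marginal u 1 * x := by
  rcases le_total x 1 with h | h
  · calc marginal u x * x ≤ marginal u x * 1 := by gcongr; exact_mod_cast h
      _ ≤ _ := by rw [mul_one]; exact le_self_add
  · calc marginal u x * x ≤ marginal u 1 * x := by gcongr; exact hu.strictAnti_marginal.antitone h
      _ ≤ _ := le_add_self

end Utility

/-! ### Regrouping independent families. -/

section Independence

variable {Ω A B C D : Type*} [MeasurableSpace Ω] [MeasurableSpace A] [MeasurableSpace B]
  [MeasurableSpace C] [MeasurableSpace D] {μ : Measure Ω} [IsProbabilityMeasure μ]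

/-- Both hypotheses say that a joint law is a product measure; the claim is associativity of
products of measures. -/
theorem indepFun_prod_right_of_prod_left {X : Ω → A} {Y : Ω → B} {W : Ω → C} (hX : Measurable X)
    (hY : Measurable Y) (hW : Measurable W) (h₁ : IndepFun X Y μ)
    (h₂ : IndepFun (fun ω => (X ω, Y ω)) W μ) : IndepFun X (fun ω => (Y ω, W ω)) μ := by
  have h₃ : IndepFun Y W μ := h₂.comp measurable_snd measurable_id
  have := Measure.isProbabilityMeasure_map (μ := μ) hX.aemeasurable
  have := Measure.isProbabilityMeasure_map (μ := μ) hY.aemeasurable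
  have := Measure.isProbabilityMeasure_map (μ := μ) hW.aemeasurable
  rw [indepFun_iff_map_prod_eq_prod_map_map hX.aemeasurable (hY.prodMk hW).aemeasurable]
  rw [indepFun_iff_map_prod_eq_prod_map_map hX.aemeasurable hY.aemeasurable] at h₁
  rw [indepFun_iff_map_prod_eq_prod_map_map hY.aemeasurable hW.aemeasurable] at h₃
  rw [indepFun_iff_map_prod_eq_prod_map_map (hX.prodMk hY).aemeasurable hW.aemeasurable] at h₂
  rw [h₃, ← Measure.prodAssoc_prod, ← h₁, ← h₂,
    Measure.map_map MeasurableEquiv.prodAssoc.measurable ((hX.prodMk hY).prodMk hW)]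
  rfl

theorem indepFun_prod_left_of_prod_right {X : Ω → A} {Y : Ω → B} {W : Ω → C} (hX : Measurable X)
    (hY : Measurable Y) (hW : Measurable W) (h₁ : IndepFun Y W μ)
    (h₂ : IndepFun X (fun ω => (Y ω, W ω)) μ) : IndepFun (fun ω => (X ω, Y ω)) W μ := by
  have h := indepFun_prod_right_of_prod_left hW hY hX h₁.symm
    (h₂.symm.comp measurable_swap measurable_id)
  exact (h.comp measurable_id measurable_swap).symm

/-- This allows independence over time within each process, together with independence across
processes, to be combined into independence over time of the joint process. -/
theorem indepFun_prod_prod {X : Ω → A} {X' : Ω → B} {Y : Ω → C} {Y' : Ω → D}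
    (hX : Measurable X) (hX' : Measurable X') (hY : Measurable Y) (hY' : Measurable Y')
    (h₁ : IndepFun X X' μ) (h₂ : IndepFun Y Y' μ)
    (h : IndepFun (fun ω => (X ω, X' ω)) (fun ω => (Y ω, Y' ω)) μ) :
    IndepFun (fun ω => (X ω, Y ω)) (fun ω => (X' ω, Y' ω)) μ := by
  have a₁ := indepFun_prod_right_of_prod_left hX hX' (hY.prodMk hY') h₁ h
  have a₂ : IndepFun Y (fun ω => (Y' ω, X' ω)) μ :=
    indepFun_prod_right_of_prod_left hY hY' hX' h₂ (h.symm.comp measurable_id measurable_snd)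
  exact indepFun_prod_left_of_prod_right hX hY (hX'.prodMk hY')
    (a₂.comp measurable_id measurable_swap)
    (a₁.comp (ψ := fun p : B × C × D => (p.2.1, (p.1, p.2.2))) measurable_id
      (by fun_prop))

theorem iIndepFun.indepFun_Iic_succ {f : ℕ → Ω → A} (hm : ∀ i, Measurable (f i))
    (hf : iIndepFun f μ) (t : ℕ) :
    IndepFun (fun ω (i : Finset.Iic t) => f i ω) (f (t + 1)) μ := by
  have := hf.indepFun_finset (Finset.Iic t) {t + 1} (by simp) hm
  exact this.comp (ψ := fun p : ({t + 1} : Finset ℕ) → A => p ⟨t + 1, by simp⟩)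
    measurable_id (measurable_pi_apply _)

end Independence

/-! ### The Markov property of states and innovations. -/

section Chain

variable {Ω S E F H : Type*} [MeasurableSpace Ω] [MeasurableSpace S]
  [MeasurableSpace E] [MeasurableSpace F] [MeasurableSpace H]
  {μ : Measure Ω} {s : Shocks Ω S E F H} {P : Matrix S S ℝ}

/-- The innovations `(ε_t, ζ_t, η_t)`. -/
def Shocks.innovation (s : Shocks Ω S E F H) (t : ℕ) (ω : Ω) : E × F × H :=
  (s.ε t ω, s.ζ t ω, s.η t ω)

/-- The law of the innovations. -/
noncomputable def Shocks.innovationLaw (s : Shocks Ω S E F H) (μ : Measure Ω) :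
    Measure (E × F × H) := μ.map (s.innovation 0)

/-- States and innovations up to time `t`. -/
def Shocks.history (s : Shocks Ω S E F H) (t : ℕ) (ω : Ω) : Finset.Iic t → S × (E × F × H) :=
  fun i => (s.Z i ω, s.innovation i ω)

/-- The information available at time `t`. -/
abbrev Shocks.info (s : Shocks Ω S E F H) (t : ℕ) : MeasurableSpace Ω :=
  MeasurableSpace.comap (s.history t) inferInstance

theorem Shocks.IsDriving.measurable_innovation (hs : s.IsDriving P μ) (t : ℕ) :
    Measurable (s.innovation t) :=
  (hs.measurable_ε t).prodMk ((hs.measurable_ζ t).prodMk (hs.measurable_η t))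

theorem Shocks.IsDriving.measurable_history (hs : s.IsDriving P μ) (t : ℕ) :
    Measurable (s.history t) :=
  measurable_pi_lambda _ fun i => (hs.measurable_Z i).prodMk (hs.measurable_innovation i)

theorem Shocks.IsDriving.info_le (hs : s.IsDriving P μ) (t : ℕ) : s.info t ≤ ‹_› :=
  (hs.measurable_history t).comap_le

theorem Shocks.measurable_info_pair {i t : ℕ} (h : i ≤ t) :
    Measurable[s.info t] fun ω => (s.Z i ω, s.innovation i ω) := by
  have h1 : Measurable[s.info t] (s.history t) := comap_measurable _
  exact (measurable_pi_apply (⟨i, Finset.mem_Iic.2 h⟩ : Finset.Iic t)).comp h1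

theorem Shocks.measurable_info_Z {i t : ℕ} (h : i ≤ t) : Measurable[s.info t] (s.Z i) :=
  measurable_fst.comp (Shocks.measurable_info_pair h)

theorem Shocks.info_mono : Monotone s.info := by
  intro t t' h
  refine Measurable.comap_le ?_
  exact @measurable_pi_lambda _ _ _ (s.info t') _ _ fun i =>
    Shocks.measurable_info_pair ((Finset.mem_Iic.1 i.2).trans h)

variable [IsProbabilityMeasure μ]

theorem Shocks.IsDriving.isProbabilityMeasure_innovationLaw (hs : s.IsDriving P μ) :
    IsProbabilityMeasure (s.innovationLaw μ) :=
  Measure.isProbabilityMeasure_map (hs.measurable_innovation 0).aemeasurable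

theorem Shocks.IsDriving.map_innovation (hs : s.IsDriving P μ) (t : ℕ) :
    μ.map (s.innovation t) = s.innovationLaw μ := by
  have h₁ : ∀ t, IndepFun (s.ε t) (fun ω => (s.ζ t ω, s.η t ω)) μ := fun t =>
    hs.indep_ε.comp (φ := fun e : ℕ → E => e t) (ψ := fun p : ℕ → F × H => p t)
      (measurable_pi_apply t) (measurable_pi_apply t)
  have h₂ : ∀ t, IndepFun (s.ζ t) (s.η t) μ := fun t =>
    hs.indep_ζ.comp (φ := fun e : ℕ → F => e t) (ψ := fun p : ℕ → H => p t)
      (measurable_pi_apply t) (measurable_pi_apply t)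
  exact ((hs.ident_ε t).prodMk ((hs.ident_ζ t).prodMk (hs.ident_η t) (h₂ t) (h₂ 0))
    (h₁ t) (h₁ 0)).map_eq

/-- Discount factor and return innovations are independent of income innovations. -/
theorem Shocks.IsDriving.indepFun_income (hs : s.IsDriving P μ) :
    IndepFun (fun ω => (s.ε 0 ω, s.ζ 0 ω)) (s.η 0) μ :=
  indepFun_prod_left_of_prod_right (hs.measurable_ε 0) (hs.measurable_ζ 0) (hs.measurable_η 0)
    (hs.indep_ζ.comp (φ := fun e : ℕ → F => e 0) (ψ := fun p : ℕ → H => p 0)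
      (measurable_pi_apply 0) (measurable_pi_apply 0))
    (hs.indep_ε.comp (φ := fun e : ℕ → E => e 0) (ψ := fun p : ℕ → F × H => p 0)
      (measurable_pi_apply 0) (measurable_pi_apply 0))

/-- At a fixed next state, (ε, ζ) and η are independent. Hence discounting and returns separate from
income, and no joint moment condition is needed. -/
theorem Shocks.IsDriving.lintegral_innovationLaw_mul (hs : s.IsDriving P μ)
    {f : E × F → ℝ≥0∞} {g : H → ℝ≥0∞} (hf : Measurable f) (hg : Measurable g) :
    ∫⁻ x, f (x.1, x.2.1) * g x.2.2 ∂(s.innovationLaw μ) =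
      (∫⁻ x, f (x.1, x.2.1) ∂(s.innovationLaw μ)) * ∫⁻ x, g x.2.2 ∂(s.innovationLaw μ) := by
  have hX := hs.measurable_innovation 0
  rw [Shocks.innovationLaw, lintegral_map (by fun_prop) hX, lintegral_map (by fun_prop) hX,
    lintegral_map (by fun_prop) hX]
  exact lintegral_mul_eq_lintegral_mul_lintegral_of_indepFun
    (hf.comp ((hs.measurable_ε 0).prodMk (hs.measurable_ζ 0))) (hg.comp (hs.measurable_η 0))
    (hs.indepFun_income.comp hf hg)

theorem Shocks.IsDriving.indepFun_innovation_succ (hs : s.IsDriving P μ) (t : ℕ) :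
    IndepFun (fun ω (i : Finset.Iic t) => s.innovation i ω) (s.innovation (t + 1)) μ := by
  have hε := iIndepFun.indepFun_Iic_succ hs.measurable_ε hs.iIndep_ε t
  have hζ := iIndepFun.indepFun_Iic_succ hs.measurable_ζ hs.iIndep_ζ t
  have hη := iIndepFun.indepFun_Iic_succ hs.measurable_η hs.iIndep_η t
  have mε : Measurable (fun ω (i : Finset.Iic t) => s.ε i ω) :=
    measurable_pi_lambda _ fun i => hs.measurable_ε i
  have mζ : Measurable (fun ω (i : Finset.Iic t) => s.ζ i ω) :=
    measurable_pi_lambda _ fun i => hs.measurable_ζ i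
  have mη : Measurable (fun ω (i : Finset.Iic t) => s.η i ω) :=
    measurable_pi_lambda _ fun i => hs.measurable_η i
  have h₁ := indepFun_prod_prod mζ (hs.measurable_ζ _) mη (hs.measurable_η _) hζ hη
    (hs.indep_ζ.comp
      (φ := fun e : ℕ → F => ((fun i : Finset.Iic t => e i), e (t + 1)))
      (ψ := fun e : ℕ → H => ((fun i : Finset.Iic t => e i), e (t + 1)))
      (by fun_prop) (by fun_prop))
  have h₂ := indepFun_prod_prod mε (hs.measurable_ε _) (mζ.prodMk mη)
    ((hs.measurable_ζ _).prodMk (hs.measurable_η _)) hε h₁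
    (hs.indep_ε.comp
      (φ := fun e : ℕ → E => ((fun i : Finset.Iic t => e i), e (t + 1)))
      (ψ := fun e : ℕ → F × H =>
        (((fun i : Finset.Iic t => (e i).1), (fun i : Finset.Iic t => (e i).2)), e (t + 1)))
      (by fun_prop) (by fun_prop))
  exact h₂.comp
    (φ := fun e : (Finset.Iic t → E) × (Finset.Iic t → F) × (Finset.Iic t → H) =>
      fun i : Finset.Iic t => (e.1 i, e.2.1 i, e.2.2 i)) (by fun_prop) measurable_id

/-- The entire state path, the past innovations and the next innovation are independent, since
states are independent of all innovations and the latter are independent over time. -/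
theorem Shocks.IsDriving.indep_path (hs : s.IsDriving P μ) (t : ℕ) {A : Set (ℕ → S)}
    {C : Set (Finset.Iic t → E × F × H)} {B : Set (E × F × H)} (hA : MeasurableSet A)
    (hC : MeasurableSet C) (hB : MeasurableSet B) :
    μ ((fun ω t => s.Z t ω) ⁻¹' A ∩ ((fun ω (i : Finset.Iic t) => s.innovation i ω) ⁻¹' C ∩
        s.innovation (t + 1) ⁻¹' B)) =
      μ ((fun ω t => s.Z t ω) ⁻¹' A) *
        μ ((fun ω (i : Finset.Iic t) => s.innovation i ω) ⁻¹' C) * s.innovationLaw μ B := by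
  have h := hs.indep_Z.comp (φ := id)
    (ψ := fun e : ℕ → E × F × H => ((fun i : Finset.Iic t => e i), e (t + 1)))
    measurable_id (by fun_prop)
  have h₁ := h.measure_inter_preimage_eq_mul A (C ×ˢ B) hA (hC.prod hB)
  have h₂ := (hs.indepFun_innovation_succ t).measure_inter_preimage_eq_mul C B hC hB
  rw [← Measure.map_apply (hs.measurable_innovation _) hB, hs.map_innovation] at h₂
  rw [mul_assoc, ← h₂]
  exact h₁

variable [Fintype S] [MeasurableSingletonClass S]

theorem Shocks.IsDriving.measure_path (hs : s.IsDriving P μ) (n : ℕ)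
    (z : ℕ → S) :
    μ {ω | ∀ t ≤ n + 1, s.Z t ω = z t} =
      μ {ω | ∀ t ≤ n, s.Z t ω = z t} * ENNReal.ofReal (P (z n) (z (n + 1))) := by
  have h : μ.real {ω | ∀ t ≤ n + 1, s.Z t ω = z t} =
      μ.real {ω | ∀ t ≤ n, s.Z t ω = z t} * P (z n) (z (n + 1)) := by
    rw [hs.markov, hs.markov, Finset.prod_range_succ, mul_assoc]
  rw [← ofReal_measureReal, h, ENNReal.ofReal_mul measureReal_nonneg, ofReal_measureReal]

/-- The Markov property on events. -/
theorem Shocks.IsDriving.measure_inter_succ (hs : s.IsDriving P μ)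
    (t : ℕ) (y y' : S) {A : Set Ω} (hA : MeasurableSet[s.info t] A) {B : Set (E × F × H)}
    (hB : MeasurableSet B) :
    μ (A ∩ s.Z t ⁻¹' {y} ∩ s.Z (t + 1) ⁻¹' {y'} ∩ s.innovation (t + 1) ⁻¹' B) =
      μ (A ∩ s.Z t ⁻¹' {y}) * ENNReal.ofReal (P y y') * s.innovationLaw μ B := by
  obtain ⟨C, hC, rfl⟩ := hA
  set Zp : Ω → Finset.Iic t → S := fun ω i => s.Z i ω with hZp
  have mZp : Measurable Zp := measurable_pi_lambda _ fun i => hs.measurable_Z i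
  have split : ∀ D : Set Ω, μ D = ∑ z : Finset.Iic t → S, μ (Zp ⁻¹' {z} ∩ D) := by
    intro D
    have := sum_measure_preimage_singleton (μ := μ.restrict D) (f := Zp) Finset.univ
      (fun z _ => mZp (measurableSet_singleton z))
    simp only [Finset.coe_univ, Set.preimage_univ, Measure.restrict_apply_univ] at this
    rw [← this]
    exact Finset.sum_congr rfl fun z _ =>
      Measure.restrict_apply (mZp (measurableSet_singleton z))
  -- Finiteness of the state space lets the event be cut according to the whole state path up to t;
  -- on each piece the states are constants.
  rw [split, split (_ ∩ _), Finset.sum_mul, Finset.sum_mul]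
  refine Finset.sum_congr rfl fun z _ => ?_
  by_cases hz : z ⟨t, by simp⟩ = y
  swap
  · have e₁ : Zp ⁻¹' {z} ∩ (s.history t ⁻¹' C ∩ s.Z t ⁻¹' {y}) = ∅ := by
      ext ω
      simp only [hZp, Set.mem_inter_iff, Set.mem_preimage, Set.mem_singleton_iff,
        Set.mem_empty_iff_false, iff_false]
      rintro ⟨rfl, -, h⟩
      exact hz h
    rw [Set.inter_assoc _ (s.Z (t + 1) ⁻¹' {y'}), ← Set.inter_assoc, e₁]
    simp
  -- With the state path frozen at z, the history event becomes an event about innovations alone.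
  set C' : Set (Finset.Iic t → E × F × H) := {x | (fun i => (z i, x i)) ∈ C} with hC'
  have mC' : MeasurableSet C' := by
    have : Measurable fun (x : Finset.Iic t → E × F × H) (i : Finset.Iic t) => (z i, x i) := by
      fun_prop
    exact this hC
  -- This is the path z continued by y' at time t + 1; only its values up to t + 1 are used.
  let zz : ℕ → S := fun i => if h : i ≤ t then z ⟨i, Finset.mem_Iic.2 h⟩ else y'
  have hzz : zz t = y := by simp [zz, hz]
  have hzz' : zz (t + 1) = y' := by simp [zz]
  have hpath : ∀ ω, Zp ω = z ↔ ∀ i ≤ t, s.Z i ω = zz i := by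
    intro ω
    rw [funext_iff]
    constructor
    · intro h i hi
      simpa [zz, hi] using h ⟨i, Finset.mem_Iic.2 hi⟩
    · intro h i
      simpa [zz, Finset.mem_Iic.1 i.2] using h i (Finset.mem_Iic.1 i.2)
  have mpath : ∀ n, MeasurableSet {w : ℕ → S | ∀ i ≤ n, w i = zz i} := by
    intro n
    have : {w : ℕ → S | ∀ i ≤ n, w i = zz i} = ⋂ i ∈ Finset.Iic n, (fun w => w i) ⁻¹' {zz i} := by
      ext w; simp
    rw [this]
    exact Finset.measurableSet_biInter _ fun i _ => measurable_pi_apply i (measurableSet_singleton _)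
  have e₁ := hs.indep_path t (mpath (t + 1)) mC' hB
  have e₂ := hs.indep_path t (mpath t) mC' MeasurableSet.univ
  have s₁ : Zp ⁻¹' {z} ∩ (s.history t ⁻¹' C ∩ s.Z t ⁻¹' {y} ∩ s.Z (t + 1) ⁻¹' {y'} ∩
      s.innovation (t + 1) ⁻¹' B) = (fun ω t => s.Z t ω) ⁻¹' {w | ∀ i ≤ t + 1, w i = zz i} ∩
      ((fun ω (i : Finset.Iic t) => s.innovation i ω) ⁻¹' C' ∩ s.innovation (t + 1) ⁻¹' B) := by
    ext ω
    simp only [Set.mem_inter_iff, Set.mem_preimage, Set.mem_singleton_iff, Set.mem_ofPred_eq, hpath]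
    constructor
    · rintro ⟨h1, ⟨⟨h2, h3⟩, h4⟩, h5⟩
      refine ⟨?_, ?_, h5⟩
      · intro i hi
        rcases Nat.le_succ_iff.1 hi with hi | rfl
        · exact h1 i hi
        · rw [hzz', h4]
      · rw [hC', Set.mem_ofPred_eq, ← (hpath ω).2 h1]; exact h2
    · rintro ⟨h1, h2, h3⟩
      have h0 : ∀ i ≤ t, s.Z i ω = zz i := fun i hi => h1 i (hi.trans (Nat.le_succ t))
      refine ⟨h0, ⟨⟨?_, (h0 t le_rfl).trans hzz⟩, (h1 _ le_rfl).trans hzz'⟩, h3⟩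
      rw [hC', Set.mem_ofPred_eq, ← (hpath ω).2 h0] at h2; exact h2
  have s₂ : Zp ⁻¹' {z} ∩ (s.history t ⁻¹' C ∩ s.Z t ⁻¹' {y}) =
      (fun ω t => s.Z t ω) ⁻¹' {w | ∀ i ≤ t, w i = zz i} ∩
      ((fun ω (i : Finset.Iic t) => s.innovation i ω) ⁻¹' C' ∩
        s.innovation (t + 1) ⁻¹' Set.univ) := by
    ext ω
    simp only [Set.mem_inter_iff, Set.mem_preimage, Set.mem_singleton_iff, Set.mem_ofPred_eq, hpath,
      Set.mem_univ, and_true]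
    constructor
    · rintro ⟨h1, h2, h3⟩
      refine ⟨h1, ?_⟩
      rw [hC', Set.mem_ofPred_eq, ← (hpath ω).2 h1]; exact h2
    · rintro ⟨h0, h2⟩
      refine ⟨h0, ?_, (h0 t le_rfl).trans hzz⟩
      rw [hC', Set.mem_ofPred_eq, ← (hpath ω).2 h0] at h2; exact h2
  have := hs.isProbabilityMeasure_innovationLaw
  have e₃ : μ ((fun ω t => s.Z t ω) ⁻¹' {w | ∀ i ≤ t + 1, w i = zz i}) =
      μ ((fun ω t => s.Z t ω) ⁻¹' {w | ∀ i ≤ t, w i = zz i}) * ENNReal.ofReal (P y y') := by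
    rw [← hzz, ← hzz']; exact hs.measure_path t zz
  rw [s₁, s₂, e₁, e₂, measure_univ, mul_one, e₃]
  ring

/-- The stationary law charges every state. -/
theorem Shocks.IsDriving.measureReal_state_pos (hs : s.IsDriving P μ) (hP : P.IsIrreducible)
    (y : S) : 0 < μ.real {ω | s.Z 0 ω = y} := by
  classical
  set p : S → ℝ := fun z => μ.real {ω | s.Z 0 ω = z}
  have hsum : ∀ D : Set Ω, μ.real D = ∑ z : S, μ.real (s.Z 0 ⁻¹' {z} ∩ D) := by
    intro D
    have := sum_measureReal_preimage_singleton (μ := μ.restrict D) (f := s.Z 0) Finset.univ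
      (fun z _ => hs.measurable_Z 0 (measurableSet_singleton z))
    simp only [Finset.coe_univ, Set.preimage_univ, measureReal_restrict_apply_univ] at this
    rw [← this]
    exact Finset.sum_congr rfl fun z _ =>
      measureReal_restrict_apply (hs.measurable_Z 0 (measurableSet_singleton z))
  -- The stationary law is invariant under every power of P. It charges some state since its mass is
  -- one, and irreducibility carries that mass to y.
  have hinv : Matrix.vecMul p P = p := by
    ext z'
    rw [← show μ.real {ω | s.Z 1 ω = z'} = p z' from hs.stationary z', hsum]
    refine Finset.sum_congr rfl fun z _ => ?_
    have := hs.markov 1 (fun t => if t = 0 then z else z')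
    simp only [Finset.range_one, Finset.prod_singleton] at this
    simp only [if_true, zero_add, one_ne_zero, if_false] at this
    refine Eq.trans this.symm (congrArg _ ?_)
    ext ω
    simp only [Set.mem_ofPred_eq, Set.mem_inter_iff, Set.mem_preimage, Set.mem_singleton_iff]
    constructor
    · exact fun h => ⟨by simpa using h 0 zero_le_one, by simpa using h 1 le_rfl⟩
    · rintro ⟨h0, h1⟩ t ht
      interval_cases t <;> simpa
  have hinv' : ∀ k : ℕ, Matrix.vecMul p (P ^ k) = p := by
    intro k
    induction k with
    | zero => simp
    | succ k ih => rw [pow_succ, ← Matrix.vecMul_vecMul, ih, hinv]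
  obtain ⟨z, hz⟩ : ∃ z, 0 < p z := by
    by_contra! h
    have h1 := hsum Set.univ
    simp only [Set.inter_univ, probReal_univ] at h1
    have : ∑ z, μ.real (s.Z 0 ⁻¹' {z}) ≤ 0 := Finset.sum_nonpos fun z _ => h z
    linarith
  obtain ⟨k, -, hk⟩ := (Matrix.isIrreducible_iff_exists_pow_pos hP.nonneg).1 hP z y
  have hpk : ∀ i j, 0 ≤ (P ^ k) i j := Matrix.pow_apply_nonneg hP.nonneg k
  show 0 < p y
  rw [← hinv' k]
  exact lt_of_lt_of_le (mul_pos hz hk) (Finset.single_le_sum (f := fun i => p i * (P ^ k) i y)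
    (fun i _ => mul_nonneg measureReal_nonneg (hpk i y)) (Finset.mem_univ z))

/-- The expectation of `g(Z_{t+1}, (ε_{t+1}, ζ_{t+1}, η_{t+1}))` given `Z_t = y`. -/
noncomputable def Shocks.nextExp (s : Shocks Ω S E F H) (μ : Measure Ω) (P : Matrix S S ℝ) (y : S)
    (g : S → E × F × H → ℝ≥0∞) : ℝ≥0∞ :=
  ∑ y', ENNReal.ofReal (P y y') * ∫⁻ x, g y' x ∂(s.innovationLaw μ)

theorem lintegral_eq_sum_fiber {ρ : Measure Ω} {V : Ω → S} (hV : Measurable V) (f : Ω → ℝ≥0∞) :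
    ∫⁻ ω, f ω ∂ρ = ∑ y, ∫⁻ ω in V ⁻¹' {y}, f ω ∂ρ := by
  rw [← tsum_fintype (L := .unconditional S), ← lintegral_iUnion (fun y => hV (measurableSet_singleton y))]
  · rw [← Set.preimage_iUnion, Set.iUnion_of_singleton, Set.preimage_univ, Measure.restrict_univ]
  · intro a b hab
    exact Disjoint.preimage _ (by simpa using hab)

/-- The Markov property: integrating out the next state and innovations. -/
theorem Shocks.IsDriving.setLIntegral_succ (hs : s.IsDriving P μ) {𝕎 : Type*} [MeasurableSpace 𝕎]
    {t : ℕ} {W : Ω → 𝕎} (hW : Measurable[s.info t] W) {G : 𝕎 → S → E × F × H → ℝ≥0∞}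
    (hG : ∀ y, Measurable fun p : 𝕎 × (E × F × H) => G p.1 y p.2) {A : Set Ω}
    (hA : MeasurableSet[s.info t] A) :
    ∫⁻ ω in A, G (W ω) (s.Z (t + 1) ω) (s.innovation (t + 1) ω) ∂μ =
      ∫⁻ ω in A, s.nextExp μ P (s.Z t ω) (G (W ω)) ∂μ := by
  have := hs.isProbabilityMeasure_innovationLaw
  have mW : Measurable W := hW.mono (hs.info_le t) le_rfl
  have mA : MeasurableSet A := hs.info_le t _ hA
  have mZ : ∀ i y, MeasurableSet (s.Z i ⁻¹' {y}) := fun i y =>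
    hs.measurable_Z i (measurableSet_singleton y)
  have mX := hs.measurable_innovation (t + 1)
  rw [lintegral_eq_sum_fiber (hs.measurable_Z t), lintegral_eq_sum_fiber (hs.measurable_Z t)]
  refine Finset.sum_congr rfl fun y _ => ?_
  rw [lintegral_eq_sum_fiber (hs.measurable_Z (t + 1))]
  have e₁ : ∫⁻ ω in s.Z t ⁻¹' {y}, s.nextExp μ P (s.Z t ω) (G (W ω)) ∂(μ.restrict A) =
      ∫⁻ ω in s.Z t ⁻¹' {y}, s.nextExp μ P y (G (W ω)) ∂(μ.restrict A) :=
    setLIntegral_congr_fun (mZ t y) fun ω hω => by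
      have : s.Z t ω = y := hω
      simp only [this]
  have mG : ∀ y', Measurable fun ω => ∫⁻ x, G (W ω) y' x ∂(s.innovationLaw μ) := fun y' =>
    (Measurable.lintegral_prod_right' (hG y')).comp mW
  rw [e₁]
  unfold Shocks.nextExp
  rw [lintegral_finsetSum _ fun y' _ => (mG y').const_mul _]
  refine Finset.sum_congr rfl fun y' _ => ?_
  rw [lintegral_const_mul _ (mG y')]
  have e₂ : ∫⁻ ω in s.Z (t + 1) ⁻¹' {y'}, G (W ω) (s.Z (t + 1) ω) (s.innovation (t + 1) ω)
      ∂((μ.restrict A).restrict (s.Z t ⁻¹' {y})) =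
      ∫⁻ ω in s.Z (t + 1) ⁻¹' {y'}, G (W ω) y' (s.innovation (t + 1) ω)
      ∂((μ.restrict A).restrict (s.Z t ⁻¹' {y})) :=
    setLIntegral_congr_fun (mZ _ y') fun ω hω => by
      have : s.Z (t + 1) ω = y' := hω
      simp only [this]
  rw [e₂]
  -- On the event that the two successive states are y and y', the adapted variable and the next
  -- innovation have a product law. Rectangles suffice, and there it is the Markov property on
  -- events.
  have e₃ : (((μ.restrict A).restrict (s.Z t ⁻¹' {y})).restrict (s.Z (t + 1) ⁻¹' {y'})).map
      (fun ω => (W ω, s.innovation (t + 1) ω)) =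
      (ENNReal.ofReal (P y y') • (((μ.restrict A).restrict (s.Z t ⁻¹' {y})).map W)).prod
        (s.innovationLaw μ) := by
    have := Measure.isFiniteMeasure_map
      (((μ.restrict A).restrict (s.Z t ⁻¹' {y})).restrict (s.Z (t + 1) ⁻¹' {y'}))
      (fun ω => (W ω, s.innovation (t + 1) ω))
    refine Measure.ext_prod fun {C B} hC hB => ?_
    rw [Measure.prod_prod, Measure.map_apply (mW.prodMk mX) (hC.prod hB), Measure.smul_apply,
      Measure.map_apply mW hC, Measure.restrict_apply ((mW.prodMk mX) (hC.prod hB)),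
      Measure.restrict_apply (((mW.prodMk mX) (hC.prod hB)).inter (mZ _ _)),
      Measure.restrict_apply ((((mW.prodMk mX) (hC.prod hB)).inter (mZ _ _)).inter (mZ _ _)),
      Measure.restrict_apply (mW hC), Measure.restrict_apply ((mW hC).inter (mZ _ _))]
    have h := hs.measure_inter_succ t y y' (A := A ∩ W ⁻¹' C)
      (MeasurableSet.inter hA (hW hC)) hB
    have s₁ : (fun ω => (W ω, s.innovation (t + 1) ω)) ⁻¹' C ×ˢ B ∩ s.Z (t + 1) ⁻¹' {y'} ∩
        s.Z t ⁻¹' {y} ∩ A = A ∩ W ⁻¹' C ∩ s.Z t ⁻¹' {y} ∩ s.Z (t + 1) ⁻¹' {y'} ∩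
          s.innovation (t + 1) ⁻¹' B := by
      ext ω; simp only [Set.mem_inter_iff, Set.mem_preimage, Set.mem_prod]; tauto
    have s₂ : W ⁻¹' C ∩ s.Z t ⁻¹' {y} ∩ A = A ∩ W ⁻¹' C ∩ s.Z t ⁻¹' {y} := by
      ext ω; simp only [Set.mem_inter_iff]; tauto
    rw [s₁, s₂, h, smul_eq_mul]
    ring
  calc _ = ∫⁻ p, G p.1 y' p.2 ∂(((μ.restrict A).restrict (s.Z t ⁻¹' {y})).restrict
        (s.Z (t + 1) ⁻¹' {y'})).map (fun ω => (W ω, s.innovation (t + 1) ω)) :=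
        (lintegral_map (hG y') (mW.prodMk mX)).symm
    _ = _ := by
      rw [e₃, lintegral_prod _ (hG y').aemeasurable, lintegral_smul_measure, smul_eq_mul,
        lintegral_map (Measurable.lintegral_prod_right' (hG y')) mW]

theorem Shocks.measurableSet_initial (t : ℕ) (z : S) :
    MeasurableSet[s.info t] {ω | s.Z 0 ω = z} :=
  Shocks.measurable_info_Z (zero_le : 0 ≤ t) (measurableSet_singleton z)

theorem lintegral_condLaw (z : S) (f : Ω → ℝ≥0∞) :
    ∫⁻ ω, f ω ∂(condLaw s μ z) = (μ {ω | s.Z 0 ω = z})⁻¹ * ∫⁻ ω in {ω | s.Z 0 ω = z}, f ω ∂μ := by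
  rw [condLaw, ProbabilityTheory.cond, lintegral_smul_measure, smul_eq_mul]

theorem Shocks.IsDriving.lintegral_succ (hs : s.IsDriving P μ) {𝕎 : Type*} [MeasurableSpace 𝕎]
    {t : ℕ} {W : Ω → 𝕎} (hW : Measurable[s.info t] W) {G : 𝕎 → S → E × F × H → ℝ≥0∞}
    (hG : ∀ y, Measurable fun p : 𝕎 × (E × F × H) => G p.1 y p.2) (z : S) :
    ∫⁻ ω, G (W ω) (s.Z (t + 1) ω) (s.innovation (t + 1) ω) ∂(condLaw s μ z) =
      ∫⁻ ω, s.nextExp μ P (s.Z t ω) (G (W ω)) ∂(condLaw s μ z) := by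
  rw [lintegral_condLaw, lintegral_condLaw, hs.setLIntegral_succ hW hG (Shocks.measurableSet_initial t z)]

theorem Shocks.IsDriving.isProbabilityMeasure_condLaw (hs : s.IsDriving P μ)
    (hP : P.IsIrreducible) (z : S) : IsProbabilityMeasure (condLaw s μ z) :=
  cond_isProbabilityMeasure fun h => by
    have := hs.measureReal_state_pos hP z
    rw [Measure.real, h] at this
    simp at this

theorem Shocks.IsDriving.ae_initial (hs : s.IsDriving P μ) (z : S) :
    ∀ᵐ ω ∂(condLaw s μ z), s.Z 0 ω = z :=
  ae_cond_mem (hs.measurable_Z 0 (measurableSet_singleton z))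

theorem Shocks.IsDriving.lintegral_one (hs : s.IsDriving P μ) (hP : P.IsIrreducible)
    {g : S → E × F × H → ℝ≥0∞} (hg : ∀ y, Measurable (g y)) (z : S) :
    ∫⁻ ω, g (s.Z 1 ω) (s.innovation 1 ω) ∂(condLaw s μ z) = s.nextExp μ P z g := by
  have := hs.isProbabilityMeasure_condLaw hP z
  have h := hs.lintegral_succ (t := 0) (W := fun _ => ()) (G := fun _ => g) measurable_const
    (fun y => (hg y).comp measurable_snd) z
  rw [h, lintegral_congr_ae (g := fun _ => s.nextExp μ P z g), lintegral_const, measure_univ,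
    mul_one]
  filter_upwards [hs.ae_initial z] with ω hω
  rw [hω]

theorem lintegral_eq_sum_condLaw (hs : s.IsDriving P μ) (hP : P.IsIrreducible) (f : Ω → ℝ≥0∞) :
    ∫⁻ ω, f ω ∂μ = ∑ z, μ {ω | s.Z 0 ω = z} * ∫⁻ ω, f ω ∂(condLaw s μ z) := by
  rw [lintegral_eq_sum_fiber (hs.measurable_Z 0)]
  refine Finset.sum_congr rfl fun z _ => ?_
  rw [lintegral_condLaw, ← mul_assoc, ENNReal.mul_inv_cancel, one_mul]
  · rfl
  · intro h
    have := hs.measureReal_state_pos hP z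
    rw [Measure.real, h] at this
    simp at this
  · exact measure_ne_top _ _

end Chain

/-! ### From growth rates to convergent Neumann series. -/

section Growth

variable {Ω S E F H : Type*} [MeasurableSpace Ω] [MeasurableSpace S]
  [MeasurableSpace E] [MeasurableSpace F] [MeasurableSpace H]
  {μ : Measure Ω} {s : Shocks Ω S E F H} {P : Matrix S S ℝ} [Fintype S]

/-- The weighted transition operator `h ↦ 𝔼_y φ(Z_1, X_1) h(Z_1)`. -/
noncomputable def Shocks.growthOp (s : Shocks Ω S E F H) (μ : Measure Ω) (P : Matrix S S ℝ)
    (φ : S → E × F × H → ℝ≥0) (h : S → ℝ≥0∞) (y : S) : ℝ≥0∞ :=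
  ∑ y', ENNReal.ofReal (P y y') * (∫⁻ x, φ y' x ∂(s.innovationLaw μ)) * h y'

theorem Shocks.nextExp_mono {g g' : S → E × F × H → ℝ≥0∞} (h : ∀ y x, g y x ≤ g' y x) (y : S) :
    s.nextExp μ P y g ≤ s.nextExp μ P y g' :=
  Finset.sum_le_sum fun y' _ => by gcongr; exact h _ _

theorem Shocks.nextExp_const_mul {g : S → E × F × H → ℝ≥0∞} (hg : ∀ y, Measurable (g y))
    (c : ℝ≥0∞) (y : S) :
    s.nextExp μ P y (fun y' x => c * g y' x) = c * s.nextExp μ P y g := by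
  unfold Shocks.nextExp
  rw [Finset.mul_sum]
  refine Finset.sum_congr rfl fun y' _ => ?_
  rw [lintegral_const_mul _ (hg y')]
  ring

theorem Shocks.nextExp_add {g g' : S → E × F × H → ℝ≥0∞} (hg : ∀ y, Measurable (g y)) (y : S) :
    s.nextExp μ P y (fun y' x => g y' x + g' y' x) =
      s.nextExp μ P y g + s.nextExp μ P y g' := by
  unfold Shocks.nextExp
  rw [← Finset.sum_add_distrib]
  refine Finset.sum_congr rfl fun y' _ => ?_
  rw [lintegral_add_left (hg y'), mul_add]

theorem Shocks.nextExp_mul_state {φ : S → E × F × H → ℝ≥0} (hφ : ∀ y, Measurable (φ y))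
    (h : S → ℝ≥0∞) (y : S) :
    s.nextExp μ P y (fun y' x => φ y' x * h y') = s.growthOp μ P φ h y := by
  unfold Shocks.nextExp Shocks.growthOp
  refine Finset.sum_congr rfl fun y' _ => ?_
  rw [lintegral_mul_const _ (hφ y').coe_nnreal_ennreal, mul_assoc]

variable {φ : S → E × F × H → ℝ≥0}

theorem Shocks.growthOp_mono {h h' : S → ℝ≥0∞} (hh : h ≤ h') :
    s.growthOp μ P φ h ≤ s.growthOp μ P φ h' :=
  fun y => Finset.sum_le_sum fun y' _ => by gcongr; exact hh y'

theorem Shocks.growthOp_const_mul (c : ℝ≥0∞) (h : S → ℝ≥0∞) :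
    s.growthOp μ P φ (fun y => c * h y) = fun y => c * s.growthOp μ P φ h y := by
  ext y
  unfold Shocks.growthOp
  rw [Finset.mul_sum]
  exact Finset.sum_congr rfl fun y' _ => by ring

theorem Shocks.growthOp_iterate_le {b : S → ℝ≥0∞} {c : ℝ≥0∞} (hb : ∀ y, b y ≤ c) (n : ℕ) :
    (s.growthOp μ P φ)^[n] b ≤ fun y => c * (s.growthOp μ P φ)^[n] 1 y := by
  induction n with
  | zero => intro y; simpa using hb y
  | succ n ih =>
    rw [Function.iterate_succ_apply', Function.iterate_succ_apply', ← Shocks.growthOp_const_mul]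
    exact Shocks.growthOp_mono ih

/-- The solution `h = ∑ₙ Kⁿ b` of `h = b + K h` for `K = growthOp φ`. -/
noncomputable def Shocks.resolvent (s : Shocks Ω S E F H) (μ : Measure Ω) (P : Matrix S S ℝ)
    (φ : S → E × F × H → ℝ≥0) (b : S → ℝ≥0∞) (y : S) : ℝ≥0∞ :=
  ∑' n, (s.growthOp μ P φ)^[n] b y

/-- Split off the zeroth term of the Neumann series; exchanging the finite state sum with the series
identifies the rest. -/
theorem Shocks.resolvent_eq (b : S → ℝ≥0∞) (y : S) :
    s.resolvent μ P φ b y = b y + s.growthOp μ P φ (s.resolvent μ P φ b) y := by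
  conv_lhs => rw [Shocks.resolvent, tsum_eq_zero_add' ENNReal.summable]
  rw [Function.iterate_zero, id]
  congr 1
  conv_rhs => unfold Shocks.growthOp
  simp_rw [Shocks.resolvent, ← ENNReal.tsum_mul_left]
  rw [← Summable.tsum_finsetSum fun _ _ => ENNReal.summable]
  simp_rw [Function.iterate_succ_apply']
  rfl

theorem Shocks.resolvent_ne_top {b : S → ℝ≥0∞} (hb : ∀ y, b y ≠ ⊤)
    (hφ : ∀ y, s.resolvent μ P φ 1 y ≠ ⊤) (y : S) : s.resolvent μ P φ b y ≠ ⊤ := by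
  have h : s.resolvent μ P φ b y ≤ (∑ z, b z) * s.resolvent μ P φ 1 y := by
    unfold Shocks.resolvent
    rw [← ENNReal.tsum_mul_left]
    exact ENNReal.tsum_le_tsum fun n => Shocks.growthOp_iterate_le
      (fun z => Finset.single_le_sum (f := b) (fun _ _ => zero_le) (Finset.mem_univ z)) n y
  exact ne_top_of_le_ne_top
    (ENNReal.mul_ne_top (ENNReal.sum_ne_top.2 fun z _ => hb z) (hφ y)) h

variable [IsProbabilityMeasure μ] [MeasurableSingletonClass S]

theorem Shocks.IsDriving.measurable_process (hs : s.IsDriving P μ) {β : Type*} [MeasurableSpace β]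
    {f : S → E × F × H → β} (hf : ∀ y, Measurable (f y)) (t : ℕ) :
    Measurable fun ω => f (s.Z t ω) (s.innovation t ω) :=
  (measurable_from_prod_countable_right (f := Function.uncurry f) hf).comp
    ((hs.measurable_Z t).prodMk (hs.measurable_innovation t))

theorem Shocks.measurable_info_process {β : Type*} [MeasurableSpace β]
    {f : S → E × F × H → β} (hf : ∀ y, Measurable (f y)) {i t : ℕ} (h : i ≤ t) :
    Measurable[s.info t] fun ω => f (s.Z i ω) (s.innovation i ω) :=
  (measurable_from_prod_countable_right (f := Function.uncurry f) hf).comp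
    (Shocks.measurable_info_pair h)

theorem Shocks.measurable_info_prod (hφ : ∀ y, Measurable (φ y)) (t : ℕ) :
    Measurable[s.info t] fun ω => ∏ i ∈ Finset.Icc 1 t, φ (s.Z i ω) (s.innovation i ω) := by
  let := s.info t
  exact Finset.measurable_prod _ fun i hi =>
    Shocks.measurable_info_process hφ (Finset.mem_Icc.1 hi).2

/-- Conditioning on the information one period before the end integrates out the last factor and
replaces h by K h, which is why the induction must allow all h. -/
theorem Shocks.IsDriving.lintegral_prod_mul_state (hs : s.IsDriving P μ) (hP : P.IsIrreducible)
    (hφ : ∀ y, Measurable (φ y)) (n : ℕ) (h : S → ℝ≥0∞) (z : S) :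
    ∫⁻ ω, ((∏ t ∈ Finset.Icc 1 n, φ (s.Z t ω) (s.innovation t ω) : ℝ≥0) : ℝ≥0∞) * h (s.Z n ω)
      ∂(condLaw s μ z) = (s.growthOp μ P φ)^[n] h z := by
  have := hs.isProbabilityMeasure_condLaw hP z
  induction n generalizing h with
  | zero =>
    rw [lintegral_congr_ae (g := fun _ => h z)]
    · simp
    · filter_upwards [hs.ae_initial z] with ω hω
      simp [hω]
  | succ n ih =>
    rw [Function.iterate_succ_apply, ← ih]
    have e := hs.lintegral_succ (t := n)
      (W := fun ω => ∏ t ∈ Finset.Icc 1 n, φ (s.Z t ω) (s.innovation t ω))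
      (G := fun w y x => (w : ℝ≥0∞) * (φ y x * h y)) (Shocks.measurable_info_prod hφ n)
      (fun y => by fun_prop) z
    calc _ = _ := lintegral_congr fun ω => by
          rw [Finset.prod_Icc_succ_top (by omega), ENNReal.coe_mul, mul_assoc]
      _ = _ := e
      _ = _ := lintegral_congr fun ω => by
          rw [Shocks.nextExp_const_mul (by fun_prop), Shocks.nextExp_mul_state hφ]

/-- This is the root test. The unconditional expectation of the n-fold product is the stationary
average of Kⁿ1, and every state has positive weight, so a growth rate below one makes the series
converge at each state. -/
theorem Shocks.IsDriving.resolvent_one_ne_top (hs : s.IsDriving P μ) (hP : P.IsIrreducible)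
    (hφ : ∀ y, Measurable (φ y))
    (hG : GrowthRateLTOne μ fun t ω => φ (s.Z t ω) (s.innovation t ω)) (z : S) :
    s.resolvent μ P φ 1 z ≠ ⊤ := by
  obtain ⟨hfin, G, hG1, hlim⟩ := hG
  set e : ℕ → ℝ≥0∞ := fun n =>
    ∫⁻ ω, ((∏ t ∈ Finset.Icc 1 n, φ (s.Z t ω) (s.innovation t ω) : ℝ≥0) : ℝ≥0∞) ∂μ
  have hle : ∀ n, μ {ω | s.Z 0 ω = z} * (s.growthOp μ P φ)^[n] 1 z ≤ e n := by
    intro n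
    have : e n = _ := lintegral_eq_sum_condLaw hs hP _
    rw [this, ← hs.lintegral_prod_mul_state hP hφ]
    simp only [Pi.one_apply, mul_one]
    exact Finset.single_le_sum (f := fun z => μ {ω | s.Z 0 ω = z} * ∫⁻ ω,
      ((∏ t ∈ Finset.Icc 1 n, φ (s.Z t ω) (s.innovation t ω) : ℝ≥0) : ℝ≥0∞) ∂(condLaw s μ z))
      (fun _ _ => zero_le) (Finset.mem_univ z)
  obtain ⟨r, hGr, hr1⟩ := exists_between hG1
  obtain ⟨N, hN⟩ := eventually_atTop.1 (hlim.eventually (gt_mem_nhds hGr))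
  -- The shift by N + 1 keeps the index positive, so that the n-th root can be undone even when N =
  -- 0.
  have hpow : ∀ n, e (n + (N + 1)) ≤ r ^ n := by
    intro n
    have h := (hN (n + (N + 1)) (by omega)).le
    have hpos : (0 : ℝ) < ((n + (N + 1) : ℕ) : ℝ) := by positivity
    have h2 := ENNReal.rpow_le_rpow h hpos.le
    rw [← ENNReal.rpow_mul, one_div, inv_mul_cancel₀ hpos.ne', ENNReal.rpow_one,
      ENNReal.rpow_natCast] at h2
    exact h2.trans (pow_le_pow_right_of_le_one' hr1.le (by omega))
  have hsum : ∑' n, e n ≠ ⊤ := by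
    rw [← Summable.sum_add_tsum_nat_add' (k := N + 1) ENNReal.summable]
    refine ENNReal.add_ne_top.2 ⟨ENNReal.sum_ne_top.2 fun n _ => (hfin n).ne, ?_⟩
    refine ne_top_of_le_ne_top ?_ (ENNReal.tsum_le_tsum hpow)
    rw [ENNReal.tsum_geometric]
    exact ENNReal.inv_ne_top.2 (tsub_pos_of_lt hr1).ne'
  intro htop
  have h : μ {ω | s.Z 0 ω = z} * s.resolvent μ P φ 1 z ≤ ∑' n, e n := by
    rw [Shocks.resolvent, ← ENNReal.tsum_mul_left]
    exact ENNReal.tsum_le_tsum hle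
  rw [htop, ENNReal.mul_top] at h
  · exact hsum (top_le_iff.1 h)
  · intro h0
    have := hs.measureReal_state_pos hP z
    rw [Measure.real, h0] at this
    simp at this

/-- A function of state and innovation that is integrable at time one is integrable at each
state. -/
theorem Shocks.IsDriving.lintegral_innovationLaw_ne_top (hs : s.IsDriving P μ)
    (hP : P.IsIrreducible) {g : S → E × F × H → ℝ≥0∞} (hg : ∀ y, Measurable (g y))
    (h : ∫⁻ ω, g (s.Z 1 ω) (s.innovation 1 ω) ∂μ < ⊤) (y : S) :
    ∫⁻ x, g y x ∂(s.innovationLaw μ) ≠ ⊤ := by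
  classical
  -- A return path of positive length to y supplies a predecessor w with P(w, y) > 0. An infinite
  -- integral at y would then make the expectation from w infinite.
  obtain ⟨k, hk0, hk⟩ := (Matrix.isIrreducible_iff_exists_pow_pos hP.nonneg).1 hP y y
  obtain ⟨k, rfl⟩ := Nat.exists_eq_succ_of_ne_zero hk0.ne'
  rw [Nat.succ_eq_add_one, pow_succ, Matrix.mul_apply] at hk
  obtain ⟨w, -, hw⟩ := Finset.exists_ne_zero_of_sum_ne_zero hk.ne'
  have hPw : 0 < P w y := lt_of_le_of_ne (hP.nonneg w y) (right_ne_zero_of_mul hw).symm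
  have hπ : μ {ω | s.Z 0 ω = w} ≠ 0 := by
    intro h0
    have := hs.measureReal_state_pos hP w
    rw [Measure.real, h0] at this
    simp at this
  rw [lintegral_eq_sum_condLaw hs hP, ENNReal.sum_lt_top] at h
  have h1 := h w (Finset.mem_univ w)
  rw [hs.lintegral_one hP hg, Shocks.nextExp] at h1
  intro htop
  have h2 : ∑ y', ENNReal.ofReal (P w y') * ∫⁻ x, g y' x ∂(s.innovationLaw μ) = ⊤ := by
    refine ENNReal.sum_eq_top.2 ⟨y, Finset.mem_univ y, ?_⟩
    rw [htop, ENNReal.mul_top]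
    simpa using hPw
  rw [h2, ENNReal.mul_top hπ] at h1
  exact h1.ne rfl

end Growth

/-! ### Discounted sums along asset paths. -/

section Paths

variable {Ω S E F H : Type*} [MeasurableSpace Ω] [Fintype S] [MeasurableSpace S]
  [MeasurableSingletonClass S] [MeasurableSpace E] [MeasurableSpace F] [MeasurableSpace H]
  {μ : Measure Ω} [IsProbabilityMeasure μ] {m : Model S E F H} {s : Shocks Ω S E F H}

/-- The discount factor as a function of state and innovations. -/
def Model.disc (m : Model S E F H) (y : S) (x : E × F × H) : ℝ≥0 := m.β (y, x.1)

/-- The gross return as a function of state and innovations. -/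
def Model.ret (m : Model S E F H) (y : S) (x : E × F × H) : ℝ≥0 := m.R (y, x.2.1)

/-- The income as a function of state and innovations. -/
def Model.inc (m : Model S E F H) (y : S) (x : E × F × H) : ℝ≥0 := m.Y (y, x.2.2)

theorem Model.IsRegular.measurable_disc (hm : m.IsRegular) (y : S) : Measurable (m.disc y) :=
  hm.measurable_β.comp (by fun_prop)

theorem Model.IsRegular.measurable_ret (hm : m.IsRegular) (y : S) : Measurable (m.ret y) :=
  hm.measurable_R.comp (by fun_prop)

theorem Model.IsRegular.measurable_inc (hm : m.IsRegular) (y : S) : Measurable (m.inc y) :=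
  hm.measurable_Y.comp (by fun_prop)

/-- The product of discount factor and return. -/
def Model.discRet (m : Model S E F H) (y : S) (x : E × F × H) : ℝ≥0 := m.disc y x * m.ret y x

theorem Model.IsRegular.measurable_discRet (hm : m.IsRegular) (y : S) :
    Measurable (m.discRet y) := (hm.measurable_disc y).mul (hm.measurable_ret y)

theorem discount_zero (ω : Ω) : discount m s 0 ω = 1 := by simp [discount]

theorem discount_succ (t : ℕ) (ω : Ω) :
    discount m s (t + 1) ω =
      discount m s t ω * m.disc (s.Z (t + 1) ω) (s.innovation (t + 1) ω) :=
  Finset.prod_Icc_succ_top (by omega) _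

theorem assetPath_succ (c : ℝ≥0 → S → ℝ≥0) (a : ℝ≥0) (t : ℕ) (ω : Ω) :
    assetPath m s c a (t + 1) ω = m.ret (s.Z (t + 1) ω) (s.innovation (t + 1) ω) *
      (assetPath m s c a t ω - c (assetPath m s c a t ω) (s.Z t ω)) +
      m.inc (s.Z (t + 1) ω) (s.innovation (t + 1) ω) := rfl

theorem Model.IsRegular.measurable_info_discount (hm : m.IsRegular) (t : ℕ) :
    Measurable[s.info t] (discount m s t) :=
  Shocks.measurable_info_prod hm.measurable_disc t

theorem Model.IsRegular.measurable_info_assetPath (hm : m.IsRegular) {c : ℝ≥0 → S → ℝ≥0}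
    (hc : Measurable (Function.uncurry c)) (a : ℝ≥0) (t : ℕ) :
    Measurable[s.info t] (assetPath m s c a t) := by
  induction t with
  | zero => exact measurable_const
  | succ t ih =>
    have ih' := ih.mono (Shocks.info_mono (Nat.le_succ t)) le_rfl
    have hZ : Measurable[s.info (t + 1)] (s.Z t) := Shocks.measurable_info_Z (Nat.le_succ t)
    let := s.info (t + 1)
    exact ((Shocks.measurable_info_process hm.measurable_ret le_rfl).mul
      (ih'.sub (hc.comp (ih'.prodMk hZ)))).add
      (Shocks.measurable_info_process hm.measurable_inc le_rfl)

theorem Model.IsRegular.measurable_info_policy (hm : m.IsRegular) {c : ℝ≥0 → S → ℝ≥0}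
    (hc : Measurable (Function.uncurry c)) (a : ℝ≥0) (t : ℕ) :
    Measurable[s.info t] fun ω => c (assetPath m s c a t ω) (s.Z t ω) := by
  have h1 := hm.measurable_info_assetPath (s := s) hc a t
  have hZ : Measurable[s.info t] (s.Z t) := Shocks.measurable_info_Z le_rfl
  let := s.info t
  exact hc.comp (h1.prodMk hZ)

/-- The summed expected discount factors are finite. -/
theorem tsum_discount_ne_top (hm : m.IsRegular) (hs : s.IsDriving m.P μ)
    (hkey : KeyConditions m s μ) (z : S) :
    ∑' t, ∫⁻ ω, (discount m s t ω : ℝ≥0∞) ∂(condLaw s μ z) ≠ ⊤ := by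
  have h := hs.resolvent_one_ne_top hm.irreducible hm.measurable_disc hkey.growth_β z
  convert h using 1
  refine tsum_congr fun t => ?_
  rw [← hs.lintegral_prod_mul_state hm.irreducible hm.measurable_disc]
  simp only [Pi.one_apply, mul_one]
  rfl

theorem KeyConditions.resolvent_discRet_ne_top (hm : m.IsRegular) (hs : s.IsDriving m.P μ)
    (hkey : KeyConditions m s μ) (z : S) : s.resolvent μ m.P m.discRet 1 z ≠ ⊤ :=
  hs.resolvent_one_ne_top hm.irreducible hm.measurable_discRet hkey.growth_βR z

theorem exists_income_bound (hm : m.IsRegular) (hs : s.IsDriving m.P μ) {g : ℝ≥0 → ℝ≥0∞}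
    (hg : Measurable g) (h : ∫⁻ ω, g (incomeAt m s 1 ω) ∂μ < ⊤) :
    ∃ C : ℝ≥0∞, C ≠ ⊤ ∧ ∀ y, ∫⁻ x, g (m.inc y x) ∂(s.innovationLaw μ) ≤ C :=
  ⟨∑ y, ∫⁻ x, g (m.inc y x) ∂(s.innovationLaw μ),
    ENNReal.sum_ne_top.2 fun y _ => hs.lintegral_innovationLaw_ne_top hm.irreducible
      (g := fun y x => g (m.inc y x)) (fun y => hg.comp (hm.measurable_inc y)) h y,
    fun y => Finset.single_le_sum (f := fun y => ∫⁻ x, g (m.inc y x) ∂(s.innovationLaw μ))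
      (fun _ _ => zero_le) (Finset.mem_univ y)⟩

theorem nextExp_mul_income_le (hs : s.IsDriving m.P μ) (hm : m.IsRegular) {φ : E × F → S → ℝ≥0}
    (hφ : ∀ y, Measurable fun x => φ x y) {g : ℝ≥0 → ℝ≥0∞} (hg : Measurable g) {C : ℝ≥0∞}
    (hC : ∀ y, ∫⁻ x, g (m.inc y x) ∂(s.innovationLaw μ) ≤ C) (y : S) :
    s.nextExp μ m.P y (fun y' x => φ (x.1, x.2.1) y' * g (m.inc y' x)) ≤
      C * s.growthOp μ m.P (fun y' x => φ (x.1, x.2.1) y') 1 y := by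
  unfold Shocks.nextExp Shocks.growthOp
  rw [Finset.mul_sum]
  refine Finset.sum_le_sum fun y' _ => ?_
  have := hs.lintegral_innovationLaw_mul (f := fun x => (φ x y' : ℝ≥0∞))
    (g := fun h => g (m.Y (y', h))) (hφ y').coe_nnreal_ennreal
    (hg.comp (hm.measurable_Y.comp (by fun_prop)))
  unfold Model.inc
  rw [this, Pi.one_apply, mul_one, ← mul_assoc, mul_comm C]
  exact mul_le_mul_right (hC y') _

/-- The income moment at each state is bounded by one finite constant and factors out of the
expectation, leaving the convergent series of expected discount factors. It serves both for income
and for its marginal utility. -/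
theorem tsum_discount_income_ne_top (hm : m.IsRegular) (hs : s.IsDriving m.P μ)
    (hkey : KeyConditions m s μ) {g : ℝ≥0 → ℝ≥0∞}
    (hg : Measurable g) (h : ∫⁻ ω, g (incomeAt m s 1 ω) ∂μ < ⊤) (z : S) :
    ∑' t, ∫⁻ ω, (discount m s (t + 1) ω : ℝ≥0∞) * g (incomeAt m s (t + 1) ω)
      ∂(condLaw s μ z) ≠ ⊤ := by
  obtain ⟨C, hC, hCb⟩ := exists_income_bound hm hs hg h
  have hr := hs.resolvent_one_ne_top hm.irreducible hm.measurable_disc hkey.growth_β z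
  have hle : ∀ t, ∫⁻ ω, (discount m s (t + 1) ω : ℝ≥0∞) * g (incomeAt m s (t + 1) ω)
      ∂(condLaw s μ z) ≤ C * (s.growthOp μ m.P m.disc)^[t + 1] 1 z := by
    intro t
    have e := hs.lintegral_succ (t := t) (W := discount m s t)
      (G := fun w y x => (w : ℝ≥0∞) * (m.disc y x * g (m.inc y x)))
      (hm.measurable_info_discount t) (fun y => by
        have := hm.measurable_disc y
        have := hm.measurable_inc y
        fun_prop) z
    have e' : ∫⁻ ω, (discount m s (t + 1) ω : ℝ≥0∞) * g (incomeAt m s (t + 1) ω)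
      ∂(condLaw s μ z) = _ := (lintegral_congr fun ω => by
        rw [discount_succ, ENNReal.coe_mul, mul_assoc]; rfl).trans e
    rw [e', Function.iterate_succ_apply,
      ← hs.lintegral_prod_mul_state hm.irreducible hm.measurable_disc, ← lintegral_const_mul' _ _ hC]
    refine lintegral_mono fun ω => ?_
    have hb := nextExp_mul_income_le hs hm (φ := fun x y => m.β (y, x.1))
      (fun y => hm.measurable_β.comp (by fun_prop)) hg hCb (s.Z t ω)
    rw [Shocks.nextExp_const_mul fun y => by
        have := hm.measurable_disc y
        have := hm.measurable_inc y
        fun_prop]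
    rw [mul_left_comm]
    exact mul_le_mul_right hb _
  refine ne_top_of_le_ne_top ?_ (ENNReal.tsum_le_tsum hle)
  rw [ENNReal.tsum_mul_left]
  refine ENNReal.mul_ne_top hC (ne_top_of_le_ne_top hr ?_)
  exact ENNReal.tsum_comp_le_tsum_of_injective (add_left_injective 1)
    fun n => (s.growthOp μ m.P m.disc)^[n] 1 z

/-- Along the asset path of any feasible policy, discounted expected wealth is summable. -/
theorem tsum_discount_assetPath_ne_top (hm : m.IsRegular) (hs : s.IsDriving m.P μ)
    (hkey : KeyConditions m s μ) {c : ℝ≥0 → S → ℝ≥0} (hc : Measurable (Function.uncurry c))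
    (a : ℝ≥0) (z : S) :
    ∑' t, ∫⁻ ω, (discount m s t ω : ℝ≥0∞) * assetPath m s c a t ω ∂(condLaw s μ z) ≠ ⊤ := by
  have hprob := hs.isProbabilityMeasure_condLaw hm.irreducible z
  set h := s.resolvent μ m.P m.discRet 1
  have hh : ∀ y, h y ≠ ⊤ := fun y => hkey.resolvent_discRet_ne_top hm hs y
  have heq : ∀ y, h y = 1 + s.growthOp μ m.P m.discRet h y := fun y => Shocks.resolvent_eq 1 y
  have mh : Measurable h := measurable_of_countable _
  have mB : ∀ t, Measurable (discount m s t) := fun t =>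
    (hm.measurable_info_discount t).mono (hs.info_le t) le_rfl
  have mA : ∀ t, Measurable (assetPath m s c a t) := fun t =>
    (hm.measurable_info_assetPath hc a t).mono (hs.info_le t) le_rfl
  have mZ := hs.measurable_Z
  have mY : ∀ t, Measurable (incomeAt m s t) := fun t =>
    hs.measurable_process hm.measurable_inc t
  -- V is a Lyapunov function: since h = 1 + K h, one period costs V exactly the expected discounted
  -- wealth, up to a multiple of expected discounted income. Dropping consumption only raises next
  -- wealth, so the estimate holds for every policy.
  set V : ℕ → ℝ≥0∞ := fun t =>
    ∫⁻ ω, (discount m s t ω : ℝ≥0∞) * assetPath m s c a t ω * h (s.Z t ω) ∂(condLaw s μ z)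
  set A : ℕ → ℝ≥0∞ := fun t =>
    ∫⁻ ω, (discount m s t ω : ℝ≥0∞) * assetPath m s c a t ω ∂(condLaw s μ z)
  set I : ℕ → ℝ≥0∞ := fun t =>
    ∫⁻ ω, (discount m s (t + 1) ω : ℝ≥0∞) * incomeAt m s (t + 1) ω ∂(condLaw s μ z)
  have hI : ∑' t, I t ≠ ⊤ := tsum_discount_income_ne_top hm hs hkey
    (g := fun y => (y : ℝ≥0∞)) measurable_coe_nnreal_ennreal hkey.income z
  have hstep : ∀ t, A t + V (t + 1) ≤ V t + (∑ y, h y) * I t := by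
    intro t
    have e := hs.lintegral_succ (t := t) (W := fun ω => (discount m s t ω, assetPath m s c a t ω))
      (G := fun w y x => (w.1 : ℝ≥0∞) * w.2 * (m.discRet y x * h y))
      ((hm.measurable_info_discount t).prodMk (hm.measurable_info_assetPath hc a t)) (fun y => by
        have := hm.measurable_discRet y
        fun_prop) z
    have e₁ : V (t + 1) ≤ ∫⁻ ω, ((discount m s t ω : ℝ≥0∞) * assetPath m s c a t ω *
        s.growthOp μ m.P m.discRet h (s.Z t ω)) ∂(condLaw s μ z) + (∑ y, h y) * I t := by
      calc V (t + 1) ≤ ∫⁻ ω, (discount m s t ω : ℝ≥0∞) * assetPath m s c a t ω *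
            (m.discRet (s.Z (t + 1) ω) (s.innovation (t + 1) ω) * h (s.Z (t + 1) ω)) +
            (∑ y, h y) * (discount m s (t + 1) ω * incomeAt m s (t + 1) ω) ∂(condLaw s μ z) := by
            refine lintegral_mono fun ω => ?_
            have hle : assetPath m s c a (t + 1) ω ≤
                m.ret (s.Z (t + 1) ω) (s.innovation (t + 1) ω) * assetPath m s c a t ω +
                incomeAt m s (t + 1) ω := by
              rw [assetPath_succ]
              exact add_le_add_left (mul_le_mul_right tsub_le_self _) _
            have hle' : (assetPath m s c a (t + 1) ω : ℝ≥0∞) ≤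
                m.ret (s.Z (t + 1) ω) (s.innovation (t + 1) ω) * assetPath m s c a t ω +
                incomeAt m s (t + 1) ω := by exact_mod_cast hle
            have hhs : h (s.Z (t + 1) ω) ≤ ∑ y, h y :=
              Finset.single_le_sum (f := h) (fun _ _ => zero_le) (Finset.mem_univ _)
            calc _ ≤ (discount m s (t + 1) ω : ℝ≥0∞) *
                  (m.ret (s.Z (t + 1) ω) (s.innovation (t + 1) ω) * assetPath m s c a t ω +
                  incomeAt m s (t + 1) ω) * h (s.Z (t + 1) ω) := by gcongr
              _ = (discount m s t ω : ℝ≥0∞) * assetPath m s c a t ω *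
                  (m.discRet (s.Z (t + 1) ω) (s.innovation (t + 1) ω) * h (s.Z (t + 1) ω)) +
                  h (s.Z (t + 1) ω) * (discount m s (t + 1) ω * incomeAt m s (t + 1) ω) := by
                rw [discount_succ, Model.discRet]; push_cast; ring
              _ ≤ _ := by gcongr
        _ = _ := by
            rw [lintegral_add_right _ (by fun_prop), lintegral_const_mul _ (by fun_prop), e]
            congr 1
            refine lintegral_congr fun ω => ?_
            rw [Shocks.nextExp_const_mul fun y => by
              have := hm.measurable_discRet y
              fun_prop, Shocks.nextExp_mul_state hm.measurable_discRet]
    calc A t + V (t + 1) ≤ A t + (∫⁻ ω, ((discount m s t ω : ℝ≥0∞) * assetPath m s c a t ω *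
        s.growthOp μ m.P m.discRet h (s.Z t ω)) ∂(condLaw s μ z) + (∑ y, h y) * I t) := by gcongr
      _ = V t + (∑ y, h y) * I t := by
        rw [← add_assoc, ← lintegral_add_left (by fun_prop)]
        congr 1
        refine lintegral_congr fun ω => ?_
        rw [heq (s.Z t ω), mul_add, mul_one]
  have hsum : ∀ T, ∑ t ∈ Finset.range T, A t + V T ≤
      V 0 + (∑ y, h y) * ∑ t ∈ Finset.range T, I t := by
    intro T
    induction T with
    | zero => simp
    | succ T ih =>
      rw [Finset.sum_range_succ, Finset.sum_range_succ, mul_add, add_assoc]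
      calc _ ≤ ∑ t ∈ Finset.range T, A t + (V T + (∑ y, h y) * I T) := add_le_add_right (hstep T) _
        _ ≤ _ := by rw [← add_assoc, ← add_assoc]; gcongr
  have hV0 : V 0 ≠ ⊤ := by
    have : V 0 = a * h z := by
      have e : V 0 = ∫⁻ _, a * h z ∂(condLaw s μ z) := by
        refine lintegral_congr_ae ?_
        filter_upwards [hs.ae_initial z] with ω hω
        simp [discount_zero, assetPath, hω]
      rw [e, lintegral_const, measure_univ, mul_one]
    rw [this]
    exact ENNReal.mul_ne_top ENNReal.coe_ne_top (hh z)
  change ∑' t, A t ≠ ⊤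
  have hfin : V 0 + (∑ y, h y) * ∑' t, I t ≠ ⊤ := ENNReal.add_ne_top.2
    ⟨hV0, ENNReal.mul_ne_top (ENNReal.sum_ne_top.2 fun y _ => hh y) hI⟩
  refine ne_top_of_le_ne_top hfin (ENNReal.tsum_le_of_sum_range_le fun T => ?_)
  calc _ ≤ _ := le_self_add
    _ ≤ _ := hsum T
    _ ≤ _ := by gcongr; exact ENNReal.sum_le_tsum _

end Paths

/-! ### Euler policies and the budget comparison at shadow prices. -/

section Verification

variable {Ω S E F H : Type*} [MeasurableSpace Ω] [Fintype S] [MeasurableSpace S]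
  [MeasurableSingletonClass S] [MeasurableSpace E] [MeasurableSpace F] [MeasurableSpace H]
  {μ : Measure Ω} [IsProbabilityMeasure μ] {m : Model S E F H} {s : Shocks Ω S E F H}

theorem IsUtility.monotone {u : ℝ≥0 → EReal} (hu : IsUtility u) : Monotone u := by
  intro x y hxy
  rcases eq_or_lt_of_le (_root_.zero_le : 0 ≤ x) with rfl | hx
  · rcases eq_or_lt_of_le hxy with rfl | hy
    · rfl
    · exact hu.zero_le y hy
  · have hy := lt_of_lt_of_le hx hxy
    rw [← hu.coe_realUtility hx, ← hu.coe_realUtility hy, EReal.coe_le_coe_iff]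
    have h1 := hu.le_tangent (x := y) (y := x) (by exact_mod_cast hy) (by exact_mod_cast hx)
    have h2 := hu.deriv_pos y (by exact_mod_cast hy)
    have h3 : (x : ℝ) ≤ y := by exact_mod_cast hxy
    nlinarith

/-- The expected discounted marginal utility of next period's wealth when saving `σ`. -/
noncomputable def eulerNext (m : Model S E F H) (s : Shocks Ω S E F H) (μ : Measure Ω)
    (c : ℝ≥0 → S → ℝ≥0) (z : S) (σ : ℝ≥0) : ℝ≥0∞ :=
  s.nextExp μ m.P z fun y x =>
    (m.discRet y x : ℝ≥0∞) * marginal m.u (c (m.ret y x * σ + m.inc y x) y)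

/-- A policy satisfying the Euler equation, with marginal utility of consumption at a bounded
distance from marginal utility of wealth. -/
structure IsEulerPolicy (m : Model S E F H) (s : Shocks Ω S E F H) (μ : Measure Ω)
    (c : ℝ≥0 → S → ℝ≥0) (M : ℝ≥0∞) : Prop where
  measurable : Measurable (Function.uncurry c)
  le : ∀ a z, c a z ≤ a
  ne_top : M ≠ ⊤
  bound : ∀ a z, marginal m.u (c a z) ≤ marginal m.u a + M
  euler : ∀ a z, 0 < a →
    marginal m.u (c a z) = max (eulerNext m s μ c z (a - c a z)) (marginal m.u a)

/-- The discounted marginal utility of consumption along the path of `c`. -/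
noncomputable def shadowPrice (m : Model S E F H) (s : Shocks Ω S E F H) (c : ℝ≥0 → S → ℝ≥0)
    (a : ℝ≥0) (t : ℕ) (ω : Ω) : ℝ≥0∞ :=
  discount m s t ω * marginal m.u (c (assetPath m s c a t ω) (s.Z t ω))

/-- Consumption along the path of `c`. -/
noncomputable def consumption (m : Model S E F H) (s : Shocks Ω S E F H) (c : ℝ≥0 → S → ℝ≥0)
    (a : ℝ≥0) (t : ℕ) (ω : Ω) : ℝ≥0 := c (assetPath m s c a t ω) (s.Z t ω)

/-- Savings along the path of `c`. -/
noncomputable def savings (m : Model S E F H) (s : Shocks Ω S E F H) (c : ℝ≥0 → S → ℝ≥0)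
    (a : ℝ≥0) (t : ℕ) (ω : Ω) : ℝ≥0 := assetPath m s c a t ω - consumption m s c a t ω

variable {c d : ℝ≥0 → S → ℝ≥0} {M : ℝ≥0∞}

theorem consumption_add_savings (hc : ∀ a z, c a z ≤ a) (a : ℝ≥0) (t : ℕ) (ω : Ω) :
    consumption m s c a t ω + savings m s c a t ω = assetPath m s c a t ω :=
  add_tsub_cancel_of_le (hc _ _)

theorem assetPath_succ' (c : ℝ≥0 → S → ℝ≥0) (a : ℝ≥0) (t : ℕ) (ω : Ω) :
    assetPath m s c a (t + 1) ω = m.ret (s.Z (t + 1) ω) (s.innovation (t + 1) ω) *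
      savings m s c a t ω + incomeAt m s (t + 1) ω := rfl

theorem Model.IsRegular.measurable_info_savings (hm : m.IsRegular)
    (hc : Measurable (Function.uncurry c)) (a : ℝ≥0) (t : ℕ) :
    Measurable[s.info t] (savings m s c a t) := by
  have h1 := hm.measurable_info_assetPath (s := s) hc a t
  have h2 := hm.measurable_info_policy (s := s) hc a t
  let := s.info t
  exact h1.sub h2

theorem IsEulerPolicy.eulerNext_le (hc : IsEulerPolicy m s μ c M) (a : ℝ≥0) (z : S) :
    eulerNext m s μ c z (a - c a z) ≤ marginal m.u (c a z) := by
  rcases eq_or_lt_of_le (zero_le : 0 ≤ a) with rfl | ha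
  · rw [le_zero_iff.1 (hc.le 0 z), marginal_zero]
    exact le_top
  · rw [hc.euler a z ha]
    exact le_max_left _ _

/-- Complementary slackness: either savings vanish, or c(a,z) < a, and then strict monotonicity of
u' rules out u'(a) as the maximum in the Euler equation. The factor of savings covers both cases. -/
theorem IsEulerPolicy.marginal_mul_savings_le (hu : IsUtility m.u) (hc : IsEulerPolicy m s μ c M)
    (a : ℝ≥0) (z : S) :
    marginal m.u (c a z) * ((a - c a z : ℝ≥0) : ℝ≥0∞) ≤
      eulerNext m s μ c z (a - c a z) * ((a - c a z : ℝ≥0) : ℝ≥0∞) := by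
  rcases eq_or_lt_of_le (hc.le a z) with h | h
  · simp [h]
  · have h1 := hu.strictAnti_marginal h
    have h2 := hc.euler a z (lt_of_le_of_lt zero_le h)
    rcases le_total (eulerNext m s μ c z (a - c a z)) (marginal m.u a) with h3 | h3
    · rw [max_eq_right h3] at h2
      exact absurd h2 h1.ne'
    · rw [max_eq_left h3] at h2
      rw [← h2]

theorem measurable_shadowPrice (hm : m.IsRegular) (hs : s.IsDriving m.P μ)
    (hc : Measurable (Function.uncurry c)) (a : ℝ≥0) (t : ℕ) :
    Measurable (shadowPrice m s c a t) :=
  (((hm.measurable_info_discount t).mono (hs.info_le t) le_rfl).coe_nnreal_ennreal).mul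
    (hm.utility.measurable_marginal.comp
      ((hm.measurable_info_policy hc a t).mono (hs.info_le t) le_rfl))

theorem measurable_eulerIntegrand (hm : m.IsRegular) (hc : Measurable (Function.uncurry c))
    (y : S) : Measurable fun p : ℝ≥0 × (E × F × H) =>
      (m.discRet y p.2 : ℝ≥0∞) * marginal m.u (c (m.ret y p.2 * p.1 + m.inc y p.2) y) := by
  have h1 := hm.measurable_discRet y
  have h2 := hm.measurable_ret y
  have h3 := hm.measurable_inc y
  have h4 := hm.utility.measurable_marginal
  have h5 : Measurable fun b : ℝ≥0 => c b y :=
    hc.comp (by fun_prop : Measurable fun b : ℝ≥0 => (b, y))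
  exact (by fun_prop : Measurable fun p : ℝ≥0 × (E × F × H) => (m.discRet y p.2 : ℝ≥0∞)).mul
    (h4.comp (h5.comp (by fun_prop)))

/-- The Markov property is applied with an arbitrary amount r invested at time t, so that it can be
used with the savings of the Euler policy and with those of its rival, both valued at the Euler
policy's prices. -/
theorem lintegral_shadowPrice_succ (hm : m.IsRegular) (hs : s.IsDriving m.P μ)
    (hc : Measurable (Function.uncurry c)) (a : ℝ≥0) (z : S) {t : ℕ} {r : Ω → ℝ≥0}
    (hr : Measurable[s.info t] r) :
    ∫⁻ ω, shadowPrice m s c a (t + 1) ω *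
        ((m.ret (s.Z (t + 1) ω) (s.innovation (t + 1) ω) * r ω : ℝ≥0) : ℝ≥0∞) ∂(condLaw s μ z) =
      ∫⁻ ω, (discount m s t ω : ℝ≥0∞) * r ω * eulerNext m s μ c (s.Z t ω) (savings m s c a t ω)
        ∂(condLaw s μ z) := by
  have e := hs.lintegral_succ (t := t)
    (W := fun ω => ((discount m s t ω, r ω), savings m s c a t ω))
    (G := fun w y x => (w.1.1 : ℝ≥0∞) * w.1.2 * ((m.discRet y x : ℝ≥0∞) *
      marginal m.u (c (m.ret y x * w.2 + m.inc y x) y)))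
    (((hm.measurable_info_discount t).prodMk hr).prodMk (hm.measurable_info_savings hc a t))
    (fun y => by
      have h := (measurable_eulerIntegrand hm hc y).comp
        (f := fun p : ((ℝ≥0 × ℝ≥0) × ℝ≥0) × (E × F × H) => (p.1.2, p.2)) (by fun_prop)
      exact (by fun_prop : Measurable fun p : ((ℝ≥0 × ℝ≥0) × ℝ≥0) × (E × F × H) =>
        (p.1.1.1 : ℝ≥0∞) * p.1.1.2).mul h) z
  calc _ = _ := lintegral_congr fun ω => by
        rw [shadowPrice, discount_succ, assetPath_succ', Model.discRet]
        push_cast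
        simp only [incomeAt, Model.inc, Shocks.innovation]
        ring
    _ = _ := e
    _ = _ := lintegral_congr fun ω => by
        exact Shocks.nextExp_const_mul (g := fun y x => (m.discRet y x : ℝ≥0∞) *
            marginal m.u (c (m.ret y x * savings m s c a t ω + m.inc y x) y))
          (fun y => (measurable_eulerIntegrand hm hc y).comp
            (f := fun x => (savings m s c a t ω, x)) (by fun_prop)) _ _

/-- The budget comparison between the path of an Euler policy and that of another policy, valued
at the shadow prices of the former. -/
theorem sum_shadowPrice_le (hm : m.IsRegular) (hs : s.IsDriving m.P μ)
    (hc : IsEulerPolicy m s μ c M) (hd : IsFeasible d) (a : ℝ≥0) (z : S) (T : ℕ) :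
    ∑ t ∈ Finset.range (T + 1),
        ∫⁻ ω, shadowPrice m s c a t ω * consumption m s d a t ω ∂(condLaw s μ z) +
      ∫⁻ ω, shadowPrice m s c a T ω * savings m s d a T ω ∂(condLaw s μ z) ≤
    ∑ t ∈ Finset.range (T + 1),
        ∫⁻ ω, shadowPrice m s c a t ω * consumption m s c a t ω ∂(condLaw s μ z) +
      ∫⁻ ω, shadowPrice m s c a T ω * savings m s c a T ω ∂(condLaw s μ z) := by
  have mq := measurable_shadowPrice hm hs hc.measurable a
  have mS : ∀ {e : ℝ≥0 → S → ℝ≥0}, Measurable (Function.uncurry e) → ∀ t,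
      Measurable (savings m s e a t) := fun he t =>
    (hm.measurable_info_savings he a t).mono (hs.info_le t) le_rfl
  have mC : ∀ {e : ℝ≥0 → S → ℝ≥0}, Measurable (Function.uncurry e) → ∀ t,
      Measurable (consumption m s e a t) := fun he t =>
    (hm.measurable_info_policy he a t).mono (hs.info_le t) le_rfl
  have mR : ∀ t, Measurable fun ω => m.ret (s.Z t ω) (s.innovation t ω) := fun t =>
    hs.measurable_process hm.measurable_ret t
  have split : ∀ {e : ℝ≥0 → S → ℝ≥0}, Measurable (Function.uncurry e) → (∀ a z, e a z ≤ a) → ∀ t,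
      ∫⁻ ω, shadowPrice m s c a t ω * consumption m s e a t ω ∂(condLaw s μ z) +
        ∫⁻ ω, shadowPrice m s c a t ω * savings m s e a t ω ∂(condLaw s μ z) =
      ∫⁻ ω, shadowPrice m s c a t ω * assetPath m s e a t ω ∂(condLaw s μ z) := by
    intro e he hle t
    have h1 := mq t
    have h2 := mC he t
    rw [← lintegral_add_left (by fun_prop)]
    refine lintegral_congr fun ω => ?_
    rw [← consumption_add_savings hle, ENNReal.coe_add, mul_add]
  induction T with
  | zero =>
    simp only [zero_add, Finset.range_one, Finset.sum_singleton]
    rw [split hd.1 hd.2, split hc.measurable hc.le]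
    rfl
  | succ T ih =>
    have step : ∀ {e : ℝ≥0 → S → ℝ≥0}, Measurable (Function.uncurry e) →
        ∫⁻ ω, shadowPrice m s c a (T + 1) ω * assetPath m s e a (T + 1) ω ∂(condLaw s μ z) =
        ∫⁻ ω, (discount m s T ω : ℝ≥0∞) * savings m s e a T ω *
          eulerNext m s μ c (s.Z T ω) (savings m s c a T ω) ∂(condLaw s μ z) +
        ∫⁻ ω, shadowPrice m s c a (T + 1) ω * incomeAt m s (T + 1) ω ∂(condLaw s μ z) := by
      intro e he
      have h1 := mq (T + 1)
      have h2 := mS he T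
      have h3 := mR (T + 1)
      rw [← lintegral_shadowPrice_succ hm hs hc.measurable a z (hm.measurable_info_savings he a T),
        ← lintegral_add_left (by fun_prop)]
      refine lintegral_congr fun ω => ?_
      rw [assetPath_succ', ENNReal.coe_add, mul_add]
    -- For the rival's savings the Euler inequality suffices.
    have hle : ∫⁻ ω, (discount m s T ω : ℝ≥0∞) * savings m s d a T ω *
          eulerNext m s μ c (s.Z T ω) (savings m s c a T ω) ∂(condLaw s μ z) ≤
        ∫⁻ ω, shadowPrice m s c a T ω * savings m s d a T ω ∂(condLaw s μ z) := by
      refine lintegral_mono fun ω => ?_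
      rw [shadowPrice, mul_right_comm]
      gcongr
      exact hc.eulerNext_le _ _
    -- For the policy's own savings the reverse inequality is needed, and complementary slackness
    -- provides it. The income term then occurs identically on both sides.
    have hge : ∫⁻ ω, shadowPrice m s c a T ω * savings m s c a T ω ∂(condLaw s μ z) ≤
        ∫⁻ ω, (discount m s T ω : ℝ≥0∞) * savings m s c a T ω *
          eulerNext m s μ c (s.Z T ω) (savings m s c a T ω) ∂(condLaw s μ z) := by
      refine lintegral_mono fun ω => ?_
      rw [shadowPrice, mul_assoc, mul_assoc, mul_comm (savings m s c a T ω : ℝ≥0∞)]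
      gcongr _ * ?_
      exact hc.marginal_mul_savings_le hm.utility _ _
    rw [Finset.sum_range_succ, add_assoc, split hd.1 hd.2, step hd.1,
      Finset.sum_range_succ _ (T + 1), add_assoc, split hc.measurable hc.le, step hc.measurable,
      ← add_assoc, ← add_assoc]
    refine add_le_add_left ?_ _
    exact (add_le_add_right hle _).trans (ih.trans (add_le_add_right hge _))

/-- From time 1 on, wealth is at least current income, so its marginal utility is at most that of
income; at time 0 wealth is positive. The bound does not depend on the policy. -/
theorem tsum_discount_marginal_ne_top (hm : m.IsRegular) (hs : s.IsDriving m.P μ)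
    (hkey : KeyConditions m s μ) {a : ℝ≥0} (ha : 0 < a) (z : S) (c : ℝ≥0 → S → ℝ≥0) :
    ∑' t, ∫⁻ ω, (discount m s t ω : ℝ≥0∞) * marginal m.u (assetPath m s c a t ω)
      ∂(condLaw s μ z) ≠ ⊤ := by
  have := hs.isProbabilityMeasure_condLaw hm.irreducible z
  rw [tsum_eq_zero_add' ENNReal.summable]
  refine ENNReal.add_ne_top.2 ⟨?_, ?_⟩
  · simp only [discount_zero, assetPath, ENNReal.coe_one, one_mul, lintegral_const, measure_univ,
      mul_one]
    exact marginal_ne_top ha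
  · refine ne_top_of_le_ne_top (tsum_discount_income_ne_top hm hs hkey
      hm.utility.measurable_marginal hkey.marginal_income z) (ENNReal.tsum_le_tsum fun t =>
        lintegral_mono fun ω => ?_)
    gcongr
    exact hm.utility.strictAnti_marginal.antitone le_add_self

theorem tsum_shadowPrice_ne_top (hm : m.IsRegular) (hs : s.IsDriving m.P μ)
    (hkey : KeyConditions m s μ) (hc : IsEulerPolicy m s μ c M) {a : ℝ≥0} (ha : 0 < a) (z : S) :
    ∑' t, ∫⁻ ω, shadowPrice m s c a t ω ∂(condLaw s μ z) ≠ ⊤ := by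
  have h1 := tsum_discount_marginal_ne_top hm hs hkey ha z c
  have h2 := tsum_discount_ne_top hm hs hkey z
  have h3 := ENNReal.add_ne_top.2 ⟨h1, ENNReal.mul_ne_top hc.ne_top h2⟩
  rw [← ENNReal.tsum_mul_left, ← ENNReal.tsum_add] at h3
  refine ne_top_of_le_ne_top h3 (ENNReal.tsum_le_tsum fun t => ?_)
  have mB := ((hm.measurable_info_discount t).mono (hs.info_le t) le_rfl).coe_nnreal_ennreal
  rw [← lintegral_const_mul _ mB, ← lintegral_add_right _ (mB.const_mul _)]
  refine lintegral_mono fun ω => ?_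
  calc _ ≤ (discount m s t ω : ℝ≥0∞) * (marginal m.u (assetPath m s c a t ω) + M) := by
        rw [shadowPrice]; gcongr; exact hc.bound _ _
    _ = _ := by rw [mul_add, mul_comm M]

/-- This is the source of the transversality condition: the terms of a convergent series tend to
zero. -/
theorem tsum_shadowPrice_wealth_ne_top (hm : m.IsRegular) (hs : s.IsDriving m.P μ)
    (hkey : KeyConditions m s μ) (hc : IsEulerPolicy m s μ c M) {a : ℝ≥0} (ha : 0 < a) (z : S) :
    ∑' t, ∫⁻ ω, shadowPrice m s c a t ω * assetPath m s c a t ω ∂(condLaw s μ z) ≠ ⊤ := by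
  have h1 := tsum_discount_marginal_ne_top hm hs hkey ha z c
  have h2 := tsum_discount_assetPath_ne_top hm hs hkey hc.measurable a z
  have h0 : marginal m.u 1 + M ≠ ⊤ :=
    ENNReal.add_ne_top.2 ⟨marginal_ne_top one_pos, hc.ne_top⟩
  have h3 := ENNReal.add_ne_top.2 ⟨h1, ENNReal.mul_ne_top h0 h2⟩
  rw [← ENNReal.tsum_mul_left, ← ENNReal.tsum_add] at h3
  refine ne_top_of_le_ne_top h3 (ENNReal.tsum_le_tsum fun t => ?_)
  have mB := ((hm.measurable_info_discount t).mono (hs.info_le t) le_rfl).coe_nnreal_ennreal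
  have mA := ((hm.measurable_info_assetPath hc.measurable a t).mono
    (hs.info_le t) le_rfl).coe_nnreal_ennreal
  rw [← lintegral_const_mul _ (by fun_prop), ← lintegral_add_right _ (by fun_prop)]
  refine lintegral_mono fun ω => ?_
  set b := assetPath m s c a t ω
  calc _ ≤ (discount m s t ω : ℝ≥0∞) * (marginal m.u b + M) * b := by
        rw [shadowPrice]; gcongr; exact hc.bound _ _
    _ = (discount m s t ω : ℝ≥0∞) * (marginal m.u b * b + M * b) := by ring
    _ ≤ (discount m s t ω : ℝ≥0∞) * (marginal m.u b + marginal m.u 1 * b + M * b) := by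
        gcongr; exact hm.utility.marginal_mul_self_le b
    _ = _ := by ring

end Verification

/-! ### Strict optimality of Euler policies. -/

section Optimality

variable {Ω S E F H : Type*} [MeasurableSpace Ω] [Fintype S] [MeasurableSpace S]
  [MeasurableSingletonClass S] [MeasurableSpace E] [MeasurableSpace F] [MeasurableSpace H]
  {μ : Measure Ω} [IsProbabilityMeasure μ] {m : Model S E F H} {s : Shocks Ω S E F H}
  {c d : ℝ≥0 → S → ℝ≥0} {M : ℝ≥0∞}

/-- Expected discounted sum of `v(c_t)` along the path of `c`. -/
noncomputable def discountedSum (m : Model S E F H) (s : Shocks Ω S E F H) (μ : Measure Ω)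
    (v : ℝ≥0 → ℝ≥0∞) (c : ℝ≥0 → S → ℝ≥0) (a : ℝ≥0) (z : S) : ℝ≥0∞ :=
  ∫⁻ ω, ∑' t, (discount m s t ω : ℝ≥0∞) * v (consumption m s c a t ω) ∂(condLaw s μ z)

theorem lifetimeValue_eq (c : ℝ≥0 → S → ℝ≥0) (a : ℝ≥0) (z : S) :
    lifetimeValue m s μ c a z =
      (discountedSum m s μ (fun x => (m.u x).toENNReal) c a z : EReal) -
        (discountedSum m s μ (fun x => (-m.u x).toENNReal) c a z : EReal) := rfl

theorem measurable_discounted (hm : m.IsRegular) (hs : s.IsDriving m.P μ)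
    (hc : Measurable (Function.uncurry c)) {v : ℝ≥0 → ℝ≥0∞} (hv : Measurable v) (a : ℝ≥0) (t : ℕ) :
    Measurable fun ω => (discount m s t ω : ℝ≥0∞) * v (consumption m s c a t ω) :=
  (((hm.measurable_info_discount t).mono (hs.info_le t) le_rfl).coe_nnreal_ennreal).mul
    (hv.comp ((hm.measurable_info_policy hc a t).mono (hs.info_le t) le_rfl))

theorem discountedSum_eq_tsum (hm : m.IsRegular) (hs : s.IsDriving m.P μ)
    (hc : Measurable (Function.uncurry c)) {v : ℝ≥0 → ℝ≥0∞} (hv : Measurable v) (a : ℝ≥0) (z : S) :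
    discountedSum m s μ v c a z =
      ∑' t, ∫⁻ ω, (discount m s t ω : ℝ≥0∞) * v (consumption m s c a t ω) ∂(condLaw s μ z) :=
  lintegral_tsum fun t => (measurable_discounted hm hs hc hv a t).aemeasurable

theorem IsUtility.measurable_toENNReal {u : ℝ≥0 → EReal} (hu : IsUtility u) :
    Measurable fun x => (u x).toENNReal :=
  hu.monotone.measurable.ereal_toENNReal

theorem IsUtility.measurable_neg_toENNReal {u : ℝ≥0 → EReal} (hu : IsUtility u) :
    Measurable fun x => (-u x).toENNReal :=
  (hu.monotone.measurable.neg).ereal_toENNReal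

theorem tsum_discount_affine_ne_top (hm : m.IsRegular) (hs : s.IsDriving m.P μ)
    (hkey : KeyConditions m s μ) {f : ℕ → Ω → ℝ≥0∞} {k : ℝ≥0∞} (hk : k ≠ ⊤) (z : S)
    (hf : ∑' t, ∫⁻ ω, f t ω ∂(condLaw s μ z) ≠ ⊤) {g : ℕ → Ω → ℝ≥0∞}
    (hg : ∀ t ω, g t ω ≤ k * discount m s t ω + f t ω) :
    ∑' t, ∫⁻ ω, g t ω ∂(condLaw s μ z) ≠ ⊤ := by
  have h2 := tsum_discount_ne_top hm hs hkey z
  have h3 := ENNReal.add_ne_top.2 ⟨ENNReal.mul_ne_top hk h2, hf⟩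
  rw [← ENNReal.tsum_mul_left, ← ENNReal.tsum_add] at h3
  refine ne_top_of_le_ne_top h3 (ENNReal.tsum_le_tsum fun t => ?_)
  have mB := ((hm.measurable_info_discount t).mono (hs.info_le t) le_rfl).coe_nnreal_ennreal
  rw [← lintegral_const_mul _ mB, ← lintegral_add_left (mB.const_mul _)]
  exact lintegral_mono fun ω => hg t ω

theorem gain_ne_top (hm : m.IsRegular) (hs : s.IsDriving m.P μ) (hkey : KeyConditions m s μ)
    (hd : IsFeasible d) (a : ℝ≥0) (z : S) :
    discountedSum m s μ (fun x => (m.u x).toENNReal) d a z ≠ ⊤ := by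
  rw [discountedSum_eq_tsum hm hs hd.1 hm.utility.measurable_toENNReal]
  have h1 := ENNReal.mul_ne_top (marginal_ne_top (u := m.u) one_pos)
    (tsum_discount_assetPath_ne_top hm hs hkey hd.1 a z)
  rw [← ENNReal.tsum_mul_left] at h1
  simp_rw [← lintegral_const_mul' _ _ (marginal_ne_top (u := m.u) one_pos)] at h1
  refine tsum_discount_affine_ne_top hm hs hkey (k := (m.u 1).toENNReal) ?_ z h1 fun t ω => ?_
  · exact EReal.toENNReal_ne_top_iff.2 (hm.utility.ne_top 1)
  · calc _ ≤ (discount m s t ω : ℝ≥0∞) *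
          ((m.u 1).toENNReal + marginal m.u 1 * consumption m s d a t ω) := by
          gcongr; exact hm.utility.toENNReal_le_linear _
      _ ≤ (discount m s t ω : ℝ≥0∞) *
          ((m.u 1).toENNReal + marginal m.u 1 * assetPath m s d a t ω) := by
          gcongr; exact hd.2 _ _
      _ = _ := by ring

/-- Only the Euler policy is known to have finite losses; a rival may have lifetime value -∞. -/
theorem loss_ne_top (hm : m.IsRegular) (hs : s.IsDriving m.P μ) (hkey : KeyConditions m s μ)
    (hc : IsEulerPolicy m s μ c M) {a : ℝ≥0} (ha : 0 < a) (z : S) :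
    discountedSum m s μ (fun x => (-m.u x).toENNReal) c a z ≠ ⊤ := by
  rw [discountedSum_eq_tsum hm hs hc.measurable hm.utility.measurable_neg_toENNReal]
  refine tsum_discount_affine_ne_top hm hs hkey (k := (-m.u 1).toENNReal) ?_ z
    (tsum_shadowPrice_ne_top hm hs hkey hc ha z) fun t ω => ?_
  · refine EReal.toENNReal_ne_top_iff.2 ?_
    rw [Ne, EReal.neg_eq_top_iff]
    exact (hm.utility.finite 1 one_pos).1
  · calc _ ≤ (discount m s t ω : ℝ≥0∞) *
          ((-m.u 1).toENNReal + marginal m.u (consumption m s c a t ω)) := by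
          gcongr; exact hm.utility.toENNReal_neg_le_marginal _
      _ = _ := by rw [mul_add, mul_comm (discount m s t ω : ℝ≥0∞)]; rfl

theorem IsEulerPolicy.pos (hc : IsEulerPolicy m s μ c M) {a : ℝ≥0} (ha : 0 < a) (z : S) :
    0 < c a z :=
  pos_of_marginal_ne_top (ne_top_of_le_ne_top
    (ENNReal.add_ne_top.2 ⟨marginal_ne_top ha, hc.ne_top⟩) (hc.bound a z))

/-- The tangent at c_t requires c_t > 0, that is, positive wealth. Zero wealth with a positive
discount factor has probability zero, because there the discounted marginal utility of wealth would
be infinite while its expectation is finite. -/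
theorem IsEulerPolicy.ae_discount_tangent (hm : m.IsRegular) (hs : s.IsDriving m.P μ)
    (hkey : KeyConditions m s μ) (hc : IsEulerPolicy m s μ c M) (d : ℝ≥0 → S → ℝ≥0)
    {a : ℝ≥0} (ha : 0 < a) (z : S) (t : ℕ) :
    ∀ᵐ ω ∂(condLaw s μ z),
      (discount m s t ω : ℝ≥0∞) * (m.u (consumption m s d a t ω)).toENNReal +
        (discount m s t ω : ℝ≥0∞) * (-m.u (consumption m s c a t ω)).toENNReal +
        shadowPrice m s c a t ω * consumption m s c a t ω ≤
      (discount m s t ω : ℝ≥0∞) * (m.u (consumption m s c a t ω)).toENNReal +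
        (discount m s t ω : ℝ≥0∞) * (-m.u (consumption m s d a t ω)).toENNReal +
        shadowPrice m s c a t ω * consumption m s d a t ω := by
  have h1 := ENNReal.ne_top_of_tsum_ne_top (tsum_discount_marginal_ne_top hm hs hkey ha z c) t
  have mB := (hm.measurable_info_discount (s := s) t).mono (hs.info_le t) le_rfl
  have mA := (hm.measurable_info_assetPath hc.measurable a t).mono (hs.info_le t) le_rfl
  have hae := ae_lt_top (mB.coe_nnreal_ennreal.mul (hm.utility.measurable_marginal.comp mA)) h1
  filter_upwards [hae] with ω hω
  rcases eq_or_ne (discount m s t ω) 0 with h0 | h0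
  · simp [shadowPrice, h0]
  · have hpos : 0 < assetPath m s c a t ω := by
      rw [pos_iff_ne_zero]
      intro hz
      simp [hz, h0] at hω
    obtain ⟨δ, -, hδ⟩ := hm.utility.ennreal_tangent (hc.pos hpos (s.Z t ω))
      (consumption m s d a t ω)
    have h2 := mul_le_mul_right (le_trans le_self_add hδ) (discount m s t ω : ℝ≥0∞)
    simp only [mul_add] at h2
    simp only [shadowPrice, mul_assoc]
    exact h2

/-- A policy satisfying the Euler equation is better than any other feasible policy, strictly so
where the first consumption choices differ. -/
theorem IsEulerPolicy.discountedSum_le (hm : m.IsRegular) (hs : s.IsDriving m.P μ)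
    (hkey : KeyConditions m s μ) (hc : IsEulerPolicy m s μ c M) (hd : IsFeasible d)
    {a : ℝ≥0} (ha : 0 < a) (z : S) :
    ∃ δ : ℝ≥0∞, (c a z ≠ d a z → δ ≠ 0) ∧
      discountedSum m s μ (fun x => (m.u x).toENNReal) d a z +
        discountedSum m s μ (fun x => (-m.u x).toENNReal) c a z + δ ≤
      discountedSum m s μ (fun x => (m.u x).toENNReal) c a z +
        discountedSum m s μ (fun x => (-m.u x).toENNReal) d a z := by
  have hprob := hs.isProbabilityMeasure_condLaw hm.irreducible z
  obtain ⟨δ, hδ0, hδ⟩ := hm.utility.ennreal_tangent (hc.pos ha z) (d a z)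
  refine ⟨δ, hδ0, ?_⟩
  set κ := condLaw s μ z
  have mv := hm.utility.measurable_toENNReal
  have mw := hm.utility.measurable_neg_toENNReal
  have mq := measurable_shadowPrice hm hs hc.measurable a
  have mC : ∀ {e : ℝ≥0 → S → ℝ≥0}, Measurable (Function.uncurry e) → ∀ t,
      Measurable (consumption m s e a t) := fun he t =>
    (hm.measurable_info_policy he a t).mono (hs.info_le t) le_rfl
  rw [discountedSum_eq_tsum hm hs hd.1 mv, discountedSum_eq_tsum hm hs hc.measurable mv,
    discountedSum_eq_tsum hm hs hd.1 mw, discountedSum_eq_tsum hm hs hc.measurable mw]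
  set p : ℕ → ℝ≥0∞ := fun t =>
    ∫⁻ ω, (discount m s t ω : ℝ≥0∞) * (m.u (consumption m s d a t ω)).toENNReal ∂κ
  set n : ℕ → ℝ≥0∞ := fun t =>
    ∫⁻ ω, (discount m s t ω : ℝ≥0∞) * (-m.u (consumption m s d a t ω)).toENNReal ∂κ
  set p' : ℕ → ℝ≥0∞ := fun t =>
    ∫⁻ ω, (discount m s t ω : ℝ≥0∞) * (m.u (consumption m s c a t ω)).toENNReal ∂κ
  set n' : ℕ → ℝ≥0∞ := fun t =>
    ∫⁻ ω, (discount m s t ω : ℝ≥0∞) * (-m.u (consumption m s c a t ω)).toENNReal ∂κ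
  set C : ℕ → ℝ≥0∞ := fun t => ∫⁻ ω, shadowPrice m s c a t ω * consumption m s c a t ω ∂κ
  set D : ℕ → ℝ≥0∞ := fun t => ∫⁻ ω, shadowPrice m s c a t ω * consumption m s d a t ω ∂κ
  set V : ℕ → ℝ≥0∞ := fun t => ∫⁻ ω, shadowPrice m s c a t ω * savings m s c a t ω ∂κ
  have hW := tsum_shadowPrice_wealth_ne_top hm hs hkey hc ha z
  have hV : Tendsto V atTop (𝓝 0) := by
    refine tendsto_of_tendsto_of_tendsto_of_le_of_le tendsto_const_nhds
      (ENNReal.tendsto_atTop_zero_of_tsum_ne_top hW) (fun t => zero_le) fun t => ?_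
    refine lintegral_mono fun ω => ?_
    gcongr
    exact tsub_le_self
  have hC : ∀ t, C t ≠ ⊤ := fun t => by
    refine ne_top_of_le_ne_top (ENNReal.ne_top_of_tsum_ne_top hW t) (lintegral_mono fun ω => ?_)
    gcongr
    exact hc.le _ _
  -- The gap is recorded only at t = 0, where wealth and state are deterministic under the
  -- conditional law.
  have hstep : ∀ t, p t + n' t + C t + (if t = 0 then δ else 0) ≤ p' t + n t + D t := by
    intro t
    have m1 := measurable_discounted hm hs hd.1 mv a t
    have m2 := measurable_discounted hm hs hc.measurable mw a t
    have m3 := (mq t).mul (mC hc.measurable t).coe_nnreal_ennreal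
    have m4 := measurable_discounted hm hs hc.measurable mv a t
    have m5 := measurable_discounted hm hs hd.1 mw a t
    have e : ∫⁻ _, (if t = 0 then δ else 0) ∂κ = (if t = 0 then δ else 0) := by
      rw [lintegral_const, measure_univ, mul_one]
    rw [← e]
    simp only [p, p', n, n', C, D]
    rw [← lintegral_add_left m1, ← lintegral_add_left m4,
      ← lintegral_add_left (by exact m1.add m2),
      ← lintegral_add_left (by exact (m1.add m2).add m3),
      ← lintegral_add_left (by exact m4.add m5)]
    refine lintegral_mono_ae ?_
    rcases eq_or_ne t 0 with rfl | ht
    · filter_upwards [hs.ae_initial z] with ω hω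
      simpa [discount_zero, shadowPrice, consumption, assetPath, hω] using hδ
    · filter_upwards [hc.ae_discount_tangent hm hs hkey d ha z t] with ω hω
      simpa [ht] using hω
  have hsum : ∀ T, ∑ t ∈ Finset.range (T + 1), p t + ∑ t ∈ Finset.range (T + 1), n' t + δ ≤
      ∑' t, p' t + ∑' t, n t + V T := by
    intro T
    have h1 := Finset.sum_le_sum fun t (_ : t ∈ Finset.range (T + 1)) => hstep t
    simp only [Finset.sum_add_distrib] at h1
    rw [Finset.sum_ite_eq' (Finset.range (T + 1)) 0, if_pos (by simp)] at h1
    have h2 : ∑ t ∈ Finset.range (T + 1), D t ≤ ∑ t ∈ Finset.range (T + 1), C t + V T :=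
      le_trans le_self_add (sum_shadowPrice_le hm hs hc hd a z T)
    have hCf : ∑ t ∈ Finset.range (T + 1), C t ≠ ⊤ := ENNReal.sum_ne_top.2 fun t _ => hC t
    -- The value of the Euler policy's own consumption is finite and can be cancelled; the rival's
    -- need not be.
    refine (ENNReal.add_le_add_iff_right hCf).1 ?_
    calc _ = ∑ t ∈ Finset.range (T + 1), p t + ∑ t ∈ Finset.range (T + 1), n' t +
          ∑ t ∈ Finset.range (T + 1), C t + δ := by ring
      _ ≤ _ := h1
      _ ≤ ∑' t, p' t + ∑' t, n t + (∑ t ∈ Finset.range (T + 1), C t + V T) := by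
          gcongr <;> exact ENNReal.sum_le_tsum _
      _ = _ := by ring
  have t1 : Tendsto (fun T => ∑ t ∈ Finset.range (T + 1), p t +
      ∑ t ∈ Finset.range (T + 1), n' t + δ) atTop (𝓝 (∑' t, p t + ∑' t, n' t + δ)) :=
    (((tendsto_add_atTop_iff_nat 1).2 (ENNReal.tendsto_nat_tsum p)).add
      ((tendsto_add_atTop_iff_nat 1).2 (ENNReal.tendsto_nat_tsum n'))).add tendsto_const_nhds
  have t2 : Tendsto (fun T => ∑' t, p' t + ∑' t, n t + V T) atTop
      (𝓝 (∑' t, p' t + ∑' t, n t)) := by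
    simpa using (tendsto_const_nhds (x := ∑' t, p' t + ∑' t, n t)).add hV
  exact le_of_tendsto_of_tendsto' t1 t2 hsum

/-- Three of the four parts are finite. If the rival's negative part N is ∞ its value is -∞, and
equality of the two values is impossible. -/
theorem coe_sub_le_coe_sub {P N P' N' δ : ℝ≥0∞} (hP : P ≠ ⊤) (hP' : P' ≠ ⊤) (hN' : N' ≠ ⊤)
    (h : P + N' + δ ≤ P' + N) :
    (P : EReal) - N ≤ (P' : EReal) - N' ∧ ((P' : EReal) - N' ≤ (P : EReal) - N → δ = 0) := by
  lift P to ℝ≥0 using hP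
  lift P' to ℝ≥0 using hP'
  lift N' to ℝ≥0 using hN'
  have e' : ((P' : ℝ≥0∞) : EReal) - ((N' : ℝ≥0∞) : EReal) = ((P' - N' : ℝ) : EReal) := by
    rw [EReal.coe_sub]; rfl
  rcases eq_or_ne N ⊤ with rfl | hN
  · have e : ((P : ℝ≥0∞) : EReal) - ((⊤ : ℝ≥0∞) : EReal) = ⊥ := by
      rw [EReal.coe_ennreal_top]; exact EReal.sub_top _
    rw [e, e']
    exact ⟨bot_le, fun h => absurd (le_bot_iff.1 h) (EReal.coe_ne_bot _)⟩
  · lift N to ℝ≥0 using hN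
    have hδ : δ ≠ ⊤ := by
      rintro rfl
      rw [add_top, top_le_iff] at h
      exact ENNReal.add_ne_top.2 ⟨ENNReal.coe_ne_top, ENNReal.coe_ne_top⟩ h
    lift δ to ℝ≥0 using hδ
    have e : ((P : ℝ≥0∞) : EReal) - ((N : ℝ≥0∞) : EReal) = ((P - N : ℝ) : EReal) := by
      rw [EReal.coe_sub]; rfl
    have h' : (P : ℝ) + N' + δ ≤ P' + N := by exact_mod_cast h
    rw [e, e', EReal.coe_le_coe_iff, EReal.coe_le_coe_iff]
    refine ⟨by linarith [δ.2], fun h2 => ?_⟩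
    have h3 : (δ : ℝ) = 0 := le_antisymm (by linarith) δ.2
    exact_mod_cast h3

theorem IsEulerPolicy.lifetimeValue_le (hm : m.IsRegular) (hs : s.IsDriving m.P μ)
    (hkey : KeyConditions m s μ) (hc : IsEulerPolicy m s μ c M) (hd : IsFeasible d)
    {a : ℝ≥0} (ha : 0 < a) (z : S) :
    lifetimeValue m s μ d a z ≤ lifetimeValue m s μ c a z ∧
      (lifetimeValue m s μ c a z ≤ lifetimeValue m s μ d a z → c a z = d a z) := by
  obtain ⟨δ, hδ, h⟩ := hc.discountedSum_le hm hs hkey hd ha z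
  have := coe_sub_le_coe_sub (gain_ne_top hm hs hkey hd a z)
    (gain_ne_top hm hs hkey ⟨hc.measurable, hc.le⟩ a z) (loss_ne_top hm hs hkey hc ha z) h
  rw [lifetimeValue_eq, lifetimeValue_eq]
  exact ⟨this.1, fun h => by_contra fun hne => hδ hne (this.2 h)⟩

end Optimality

/-! ### Existence of a fixed point by monotone time iteration. -/

section Existence

variable {Ω S E F H : Type*} [MeasurableSpace Ω] [Fintype S] [MeasurableSpace S]
  [MeasurableSingletonClass S] [MeasurableSpace E] [MeasurableSpace F] [MeasurableSpace H]
  {μ : Measure Ω} [IsProbabilityMeasure μ] {m : Model S E F H} {s : Shocks Ω S E F H}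
  {c c' d d' : ℝ≥0 → S → ℝ≥0} {h : S → ℝ≥0∞}

/-- The expected discounted marginal utility of next period's income. -/
noncomputable def incomeTerm (m : Model S E F H) (s : Shocks Ω S E F H) (μ : Measure Ω) (z : S) :
    ℝ≥0∞ :=
  s.nextExp μ m.P z fun y x => (m.discRet y x : ℝ≥0∞) * marginal m.u (m.inc y x)

/-- A bound on the distance between marginal utility of consumption and of wealth that is
preserved by time iteration. -/
noncomputable def marginalBound (m : Model S E F H) (s : Shocks Ω S E F H) (μ : Measure Ω) :
    S → ℝ≥0∞ := s.resolvent μ m.P m.discRet (incomeTerm m s μ)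

theorem lintegral_discRet_ne_top (hm : m.IsRegular) (hs : s.IsDriving m.P μ)
    (hkey : KeyConditions m s μ) (y : S) :
    ∫⁻ x, (m.discRet y x : ℝ≥0∞) ∂(s.innovationLaw μ) ≠ ⊤ := by
  refine hs.lintegral_innovationLaw_ne_top hm.irreducible
    (g := fun y x => (m.discRet y x : ℝ≥0∞))
    (fun y => (hm.measurable_discRet y).coe_nnreal_ennreal) ?_ y
  have := hkey.growth_βR.1 1
  simp only [Finset.Icc_self, Finset.prod_singleton] at this
  exact this

theorem lintegral_discRet_mul_marginal_ne_top (hm : m.IsRegular) (hs : s.IsDriving m.P μ)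
    (hkey : KeyConditions m s μ) (y : S) :
    ∫⁻ x, (m.discRet y x : ℝ≥0∞) * marginal m.u (m.inc y x) ∂(s.innovationLaw μ) ≠ ⊤ := by
  have e := hs.lintegral_innovationLaw_mul
    (f := fun x => ((m.β (y, x.1) * m.R (y, x.2) : ℝ≥0) : ℝ≥0∞))
    (g := fun x => marginal m.u (m.Y (y, x)))
    ((hm.measurable_β.comp (by fun_prop)).mul (hm.measurable_R.comp
      (by fun_prop))).coe_nnreal_ennreal
    (hm.utility.measurable_marginal.comp (hm.measurable_Y.comp (by fun_prop)))
  refine ne_of_eq_of_ne e (ENNReal.mul_ne_top (lintegral_discRet_ne_top hm hs hkey y) ?_)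
  exact hs.lintegral_innovationLaw_ne_top hm.irreducible (g := fun y x => marginal m.u (m.inc y x))
    (fun y => hm.utility.measurable_marginal.comp (hm.measurable_inc y)) hkey.marginal_income y

theorem marginalBound_ne_top (hm : m.IsRegular) (hs : s.IsDriving m.P μ)
    (hkey : KeyConditions m s μ) (z : S) : marginalBound m s μ z ≠ ⊤ := by
  have hb : ∀ y, incomeTerm m s μ y ≠ ⊤ := fun _ => ENNReal.sum_ne_top.2 fun y _ =>
    ENNReal.mul_ne_top ENNReal.ofReal_ne_top (lintegral_discRet_mul_marginal_ne_top hm hs hkey y)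
  exact Shocks.resolvent_ne_top hb (fun y => hkey.resolvent_discRet_ne_top hm hs y) z

/-- This is the equation h = b + K h for the bound. Since next wealth is at least income, it says
exactly that one step of time iteration reproduces the bound. -/
theorem nextExp_marginalBound (hm : m.IsRegular) (z : S) :
    s.nextExp μ m.P z (fun y x => (m.discRet y x : ℝ≥0∞) *
      (marginal m.u (m.inc y x) + marginalBound m s μ y)) = marginalBound m s μ z := by
  simp_rw [mul_add]
  rw [Shocks.nextExp_add, Shocks.nextExp_mul_state hm.measurable_discRet]
  · exact (Shocks.resolvent_eq (incomeTerm m s μ) z).symm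
  · exact fun y => (hm.measurable_discRet y).coe_nnreal_ennreal.mul
      (hm.utility.measurable_marginal.comp (hm.measurable_inc y))

/-- Policies for which consumption and savings are nondecreasing in wealth and marginal utility of
consumption exceeds that of wealth by at most `h`. -/
structure IsMonotonePolicy (m : Model S E F H) (h : S → ℝ≥0∞) (c : ℝ≥0 → S → ℝ≥0) : Prop where
  mono : ∀ z, Monotone fun a => c a z
  lipschitz : ∀ z a b, a ≤ b → c b z ≤ c a z + (b - a)
  le : ∀ a z, c a z ≤ a
  bound : ∀ a z, marginal m.u (c a z) ≤ marginal m.u a + h z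

/-- Consumption and savings add up to wealth and both are nondecreasing, so neither grows faster
than wealth. The constant is uniform over the class, which makes pointwise limits usable at moving
arguments. -/
theorem IsMonotonePolicy.lipschitzWith (hc : IsMonotonePolicy m h c) (z : S) :
    LipschitzWith 1 fun a => c a z := by
  refine LipschitzWith.of_dist_le_mul fun a b => ?_
  rw [NNReal.coe_one, one_mul]
  wlog hab : a ≤ b generalizing a b
  · rw [dist_comm, dist_comm a b]
    exact this b a (le_of_not_ge hab)
  have h1 : (c a z : ℝ) ≤ c b z := by exact_mod_cast hc.mono z hab
  have h2 : (c b z : ℝ) ≤ c a z + (b - a) := by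
    rw [← NNReal.coe_sub hab]; exact_mod_cast hc.lipschitz z a b hab
  have h3 : (a : ℝ) ≤ b := by exact_mod_cast hab
  rw [NNReal.dist_eq, NNReal.dist_eq, abs_sub_comm, abs_sub_comm (a : ℝ),
    abs_of_nonneg (by linarith), abs_of_nonneg (by linarith)]
  linarith

theorem IsMonotonePolicy.measurable (hc : IsMonotonePolicy m h c) :
    Measurable (Function.uncurry c) :=
  measurable_from_prod_countable_left fun z => (hc.mono z).measurable

theorem marginal_next_le (hu : IsUtility m.u) (hc : IsMonotonePolicy m h c) (σ : ℝ≥0) (y : S)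
    (x : E × F × H) :
    marginal m.u (c (m.ret y x * σ + m.inc y x) y) ≤ marginal m.u (m.inc y x) + h y :=
  (hc.bound _ _).trans (add_le_add_left (hu.strictAnti_marginal.antitone le_add_self) _)

theorem eulerNext_le_marginalBound (hm : m.IsRegular)
    (hc : IsMonotonePolicy m (marginalBound m s μ) c) (z : S) (σ : ℝ≥0) :
    eulerNext m s μ c z σ ≤ marginalBound m s μ z := by
  rw [← nextExp_marginalBound hm]
  exact Shocks.nextExp_mono (fun y x => by
    gcongr; exact marginal_next_le hm.utility hc σ y x) z

theorem eulerNext_anti (hu : IsUtility m.u) (hcc : ∀ a z, c a z ≤ c' a z)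
    (hc : ∀ z, Monotone fun a => c a z) {σ σ' : ℝ≥0} (hσ : σ ≤ σ') (z : S) :
    eulerNext m s μ c' z σ' ≤ eulerNext m s μ c z σ :=
  Shocks.nextExp_mono (fun y x => by
    gcongr ?_ * ?_
    · exact le_rfl
    · refine hu.strictAnti_marginal.antitone (le_trans (hc y ?_) (hcc _ _))
      gcongr) z

/-- Dominated convergence with the majorant β̂R̂(u'(Ŷ) + h(Ẑ)). Policies and savings vary together,
and the common Lipschitz constant handles the moving argument. A constant sequence of policies gives
continuity in savings. -/
theorem tendsto_eulerNext (hm : m.IsRegular) (hs : s.IsDriving m.P μ) (hkey : KeyConditions m s μ)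
    {c : ℕ → ℝ≥0 → S → ℝ≥0} (hc : ∀ n, IsMonotonePolicy m (marginalBound m s μ) (c n))
    (hlim : ∀ a z, Tendsto (fun n => c n a z) atTop (𝓝 (c' a z))) {σ : ℕ → ℝ≥0} {σ' : ℝ≥0}
    (hσ : Tendsto σ atTop (𝓝 σ')) (z : S) :
    Tendsto (fun n => eulerNext m s μ (c n) z (σ n)) atTop (𝓝 (eulerNext m s μ c' z σ')) := by
  unfold eulerNext Shocks.nextExp
  refine tendsto_finsetSum _ fun y _ => ENNReal.Tendsto.const_mul ?_ (.inr ENNReal.ofReal_ne_top)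
  refine tendsto_lintegral_of_dominated_convergence
    (fun x => (m.discRet y x : ℝ≥0∞) * (marginal m.u (m.inc y x) + marginalBound m s μ y))
    (fun n => ?_) (fun n => ?_) ?_ ?_
  · exact (measurable_eulerIntegrand hm (hc n).measurable y).comp
      (f := fun x => (σ n, x)) (by fun_prop)
  · exact .of_forall fun x =>
      mul_le_mul_right (marginal_next_le hm.utility (hc n) (σ n) y x) _
  · simp_rw [mul_add]
    rw [lintegral_add_right _ ((hm.measurable_discRet y).coe_nnreal_ennreal.mul_const _),
      lintegral_mul_const _ (hm.measurable_discRet y).coe_nnreal_ennreal]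
    exact ENNReal.add_ne_top.2 ⟨lintegral_discRet_mul_marginal_ne_top hm hs hkey y,
      ENNReal.mul_ne_top (lintegral_discRet_ne_top hm hs hkey y)
        (marginalBound_ne_top hm hs hkey y)⟩
  · refine .of_forall fun x => ENNReal.Tendsto.const_mul ?_ (.inr ENNReal.coe_ne_top)
    refine (hm.utility.continuous_marginal.tendsto _).comp ?_
    have h1 : Tendsto (fun n => m.ret y x * σ n + m.inc y x) atTop
        (𝓝 (m.ret y x * σ' + m.inc y x)) := (hσ.const_mul _).add_const _
    set b := m.ret y x * σ' + m.inc y x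
    rw [tendsto_iff_dist_tendsto_zero]
    have h2 : Tendsto (fun n => dist (m.ret y x * σ n + m.inc y x) b + dist (c n b y) (c' b y))
        atTop (𝓝 0) := by
      simpa using (tendsto_iff_dist_tendsto_zero.1 h1).add
        (tendsto_iff_dist_tendsto_zero.1 (hlim b y))
    refine squeeze_zero (fun _ => dist_nonneg) (fun n => ?_) h2
    refine (dist_triangle _ (c n b y) _).trans (add_le_add_left ?_ _)
    simpa using ((hc n).lipschitzWith y).dist_le_mul (m.ret y x * σ n + m.inc y x) b

/-- `d` is obtained from `c` by one step of time iteration. -/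
def IsEulerIterate (m : Model S E F H) (s : Shocks Ω S E F H) (μ : Measure Ω)
    (c d : ℝ≥0 → S → ℝ≥0) : Prop :=
  ∀ a z, d a z ≤ a ∧ marginal m.u (d a z) = max (eulerNext m s μ c z (a - d a z)) (marginal m.u a)

/-- If the richer agent consumed less, it would save at least as much and so face a smaller marginal
value of savings, hence consume at least as much. The case of equal policies gives monotonicity in
wealth; that of equal wealth gives monotonicity of the iteration. -/
theorem IsEulerIterate.le_of_le (hu : IsUtility m.u) (h : IsEulerIterate m s μ c d)
    (h' : IsEulerIterate m s μ c' d') (hc : ∀ z, Monotone fun a => c a z)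
    (hcc : ∀ a z, c a z ≤ c' a z) {a a' : ℝ≥0} (ha : a ≤ a') (z : S) : d a z ≤ d' a' z := by
  by_contra! hlt
  have h1 := hu.strictAnti_marginal hlt
  rw [(h a z).2, (h' a' z).2] at h1
  refine absurd h1 (not_lt.2 (max_le_max ?_ (hu.strictAnti_marginal.antitone ha)))
  exact eulerNext_anti hu hcc hc (tsub_le_tsub ha hlt.le) z

theorem IsEulerIterate.isMonotonePolicy (hm : m.IsRegular)
    (hc : IsMonotonePolicy m (marginalBound m s μ) c) (h : IsEulerIterate m s μ c d) :
    IsMonotonePolicy m (marginalBound m s μ) d where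
  mono z a b hab := h.le_of_le hm.utility h hc.mono (fun _ _ => le_rfl) hab z
  lipschitz z a b hab := by
    by_contra! hlt
    have h1 := hm.utility.strictAnti_marginal (lt_of_le_of_lt le_self_add hlt)
    have hb := (h b z).1
    -- If consumption rose by more than wealth, then savings at a would be positive and at least
    -- those at b. The Euler equation would bind at a and give u'(d(a,z)) ≤ u'(d(b,z)), against
    -- d(a,z) < d(b,z).
    have hda : d a z < a := by
      have : d a z + (b - a) < b := lt_of_lt_of_le hlt hb
      have h2 : (d a z : ℝ) + (b - a) < b := by
        rw [← NNReal.coe_sub hab]; exact_mod_cast this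
      exact_mod_cast (by linarith : (d a z : ℝ) < a)
    have h2 := hm.utility.strictAnti_marginal hda
    have h3 := (h a z).2
    rcases le_total (eulerNext m s μ c z (a - d a z)) (marginal m.u a) with h4 | h4
    · rw [max_eq_right h4] at h3
      exact absurd h3 h2.ne'
    · rw [max_eq_left h4] at h3
      have h5 : b - d b z ≤ a - d a z := by
        have h6 : (d a z : ℝ) + (b - a) < d b z := by
          rw [← NNReal.coe_sub hab]; exact_mod_cast hlt
        rw [← NNReal.coe_le_coe, NNReal.coe_sub hb, NNReal.coe_sub hda.le]
        linarith
      have h7 := eulerNext_anti (s := s) (μ := μ) hm.utility (fun a z => le_refl (c a z)) hc.mono h5 z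
      rw [← h3] at h7
      exact absurd h1 (not_lt.2 (h7.trans ((le_max_left _ _).trans (h b z).2.ge)))
  le a z := (h a z).1
  bound a z := by
    rw [(h a z).2]
    exact max_le ((eulerNext_le_marginalBound hm hc z _).trans le_add_self) le_self_add

/-- Intermediate value theorem on [0,a]: at ξ = a the maximum is at least u'(a), and at ξ = 0
marginal utility is ∞. -/
theorem exists_isEulerIterate (hm : m.IsRegular) (hs : s.IsDriving m.P μ)
    (hkey : KeyConditions m s μ) (hc : IsMonotonePolicy m (marginalBound m s μ) c) :
    ∃ d, IsEulerIterate m s μ c d := by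
  have key : ∀ a z, ∃ ξ : ℝ≥0, ξ ≤ a ∧
      marginal m.u ξ = max (eulerNext m s μ c z (a - ξ)) (marginal m.u a) := by
    intro a z
    have hcont : Continuous fun σ => eulerNext m s μ c z σ :=
      continuous_iff_seqContinuous.2 fun σ σ' hσ =>
        tendsto_eulerNext hm hs hkey (fun _ => hc) (fun _ _ => tendsto_const_nhds) hσ z
    have hg : Continuous fun ξ => max (eulerNext m s μ c z (a - ξ)) (marginal m.u a) :=
      (hcont.comp (continuous_const.sub continuous_id)).max continuous_const
    obtain ⟨ξ, hξ, he⟩ := (isPreconnected_Icc (a := (0 : ℝ≥0)) (b := a)).intermediate_value₂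
      (a := a) (b := 0) (by simp) (by simp) hm.utility.continuous_marginal.continuousOn
      hg.continuousOn (le_max_right _ _) (by simp)
    exact ⟨ξ, hξ.2, he⟩
  choose d hd using key
  exact ⟨d, hd⟩

theorem isMonotonePolicy_id : IsMonotonePolicy m h (fun a _ => a) where
  mono _ := monotone_id
  lipschitz _ _ _ hab := (add_tsub_cancel_of_le hab).ge
  le _ _ := le_rfl
  bound _ _ := le_self_add

/-- Time iteration from the policy of consuming everything decreases to a fixed point. -/
theorem exists_isEulerIterate_self (hm : m.IsRegular) (hs : s.IsDriving m.P μ)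
    (hkey : KeyConditions m s μ) :
    ∃ (c : ℕ → ℝ≥0 → S → ℝ≥0) (c' : ℝ≥0 → S → ℝ≥0), (c 0 = fun a _ => a) ∧
      (∀ n, IsEulerIterate m s μ (c n) (c (n + 1))) ∧
      (∀ a z, Tendsto (fun n => c n a z) atTop (𝓝 (c' a z))) ∧
      IsMonotonePolicy m (marginalBound m s μ) c' ∧ IsEulerIterate m s μ c' c' := by
  have step : ∀ c : {c // IsMonotonePolicy m (marginalBound m s μ) c},
      ∃ d : {c // IsMonotonePolicy m (marginalBound m s μ) c}, IsEulerIterate m s μ c d := by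
    intro c
    obtain ⟨d, hd⟩ := exists_isEulerIterate hm hs hkey c.2
    exact ⟨⟨d, hd.isMonotonePolicy hm c.2⟩, hd⟩
  choose T hT using step
  let c : ℕ → {c // IsMonotonePolicy m (marginalBound m s μ) c} :=
    fun n => T^[n] ⟨_, isMonotonePolicy_id⟩
  have hc : ∀ n, IsEulerIterate m s μ (c n).1 (c (n + 1)).1 := fun n => by
    simp only [c, Function.iterate_succ_apply']
    exact hT _
  have hanti : ∀ n a z, (c (n + 1)).1 a z ≤ (c n).1 a z := by
    intro n
    induction n with
    | zero => exact fun a z => (c 1).2.le a z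
    | succ n ih =>
      exact fun a z => (hc (n + 1)).le_of_le hm.utility (hc n) (c (n + 1)).2.mono ih le_rfl z
  let c' : ℝ≥0 → S → ℝ≥0 := fun a z => ⨅ n, (c n).1 a z
  have hlim : ∀ a z, Tendsto (fun n => (c n).1 a z) atTop (𝓝 (c' a z)) := fun a z =>
    tendsto_atTop_ciInf (antitone_nat_of_succ_le fun n => hanti n a z) (OrderBot.bddBelow _)
  have hm' := fun a z => (hm.utility.continuous_marginal.tendsto _).comp (hlim a z)
  refine ⟨fun n => (c n).1, c', rfl, hc, hlim, ?_, ?_⟩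
  · refine ⟨fun z a b hab => ?_, fun z a b hab => ?_, fun a z => ?_, fun a z => ?_⟩
    · exact le_of_tendsto_of_tendsto' (hlim a z) (hlim b z) fun n => (c n).2.mono z hab
    · exact le_of_tendsto_of_tendsto' (hlim b z) ((hlim a z).add_const _)
        fun n => (c n).2.lipschitz z a b hab
    · exact le_of_tendsto' (hlim a z) fun n => (c n).2.le a z
    · exact le_of_tendsto' (hm' a z) fun n => (c n).2.bound a z
  · intro a z
    refine ⟨le_of_tendsto' (hlim a z) fun n => (c n).2.le a z, ?_⟩
    have h1 := (tendsto_add_atTop_iff_nat 1).2 (hlim a z)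
    refine tendsto_nhds_unique ((tendsto_add_atTop_iff_nat 1).2 (hm' a z)) ?_
    have h2 := (tendsto_eulerNext hm hs hkey (fun n => (c n).2) hlim
      (tendsto_const_nhds (x := a) |>.sub h1) z).max (tendsto_const_nhds (x := marginal m.u a))
    exact h2.congr fun n => (hc n a z).2.symm

end Existence

/-! ### The optimal consumption function and its linear lower bound. -/

section OptimalConsumption

variable {Ω S E F H : Type*} [MeasurableSpace Ω] [Fintype S] [MeasurableSpace S]
  [MeasurableSingletonClass S] [MeasurableSpace E] [MeasurableSpace F] [MeasurableSpace H]
  {μ : Measure Ω} [IsProbabilityMeasure μ] {m : Model S E F H} {s : Shocks Ω S E F H}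
  {c d : ℝ≥0 → S → ℝ≥0} {h : S → ℝ≥0∞}

/-- Since d(0,z) = 0, monotonicity extends from (0,∞) to [0,∞). -/
theorem IsCandidate.measurable (hd : IsCandidate m d) : Measurable (Function.uncurry d) := by
  refine measurable_from_prod_countable_left fun z => Monotone.measurable fun a b hab => ?_
  rcases eq_or_lt_of_le (zero_le : 0 ≤ a) with rfl | ha
  · exact (hd.le 0 z).trans zero_le
  · exact hd.monotoneOn z ha (lt_of_lt_of_le ha hab) hab

theorem eulerRHS_eq (hm : m.IsRegular) (hs : s.IsDriving m.P μ)
    (hc : Measurable (Function.uncurry c)) (ξ a : ℝ≥0) (z : S) :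
    eulerRHS m s μ c ξ a z = max (eulerNext m s μ c z (a - ξ)) (marginal m.u a) := by
  unfold eulerRHS eulerNext
  have e := hs.lintegral_one hm.irreducible (g := fun y x => (m.discRet y x : ℝ≥0∞) *
      marginal m.u (c (m.ret y x * (a - ξ) + m.inc y x) y))
    (fun y => (measurable_eulerIntegrand hm hc y).comp (f := fun x => (a - ξ, x)) (by fun_prop)) z
  rw [← e]
  congr 1

theorem IsMonotonePolicy.isCandidate (hu : IsUtility m.u) (hh : ∀ z, h z ≠ ⊤)
    (hc : IsMonotonePolicy m h c) : IsCandidate m c where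
  continuousOn z := (hc.lipschitzWith z).continuous.continuousOn
  monotoneOn z := (hc.mono z).monotoneOn _
  pos a z ha := pos_of_marginal_ne_top (ne_top_of_le_ne_top
    (ENNReal.add_ne_top.2 ⟨marginal_ne_top ha, hh z⟩) (hc.bound a z))
  le := hc.le
  bounded := by
    refine ⟨∑ z, (h z).toReal, fun a z ha => ?_⟩
    have hpos : 0 < c a z := pos_of_marginal_ne_top (ne_top_of_le_ne_top
      (ENNReal.add_ne_top.2 ⟨marginal_ne_top ha, hh z⟩) (hc.bound a z))
    have hDa := hu.deriv_pos a (by exact_mod_cast ha)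
    have h1 := hc.bound a z
    have h2 := hu.strictAnti_marginal.antitone (hc.le a z)
    rw [marginal_of_pos ha, marginal_of_pos hpos] at h1 h2
    rw [← ENNReal.ofReal_toReal (hh z), ← ENNReal.ofReal_add hDa.le ENNReal.toReal_nonneg,
      ENNReal.ofReal_le_ofReal_iff (add_nonneg hDa.le ENNReal.toReal_nonneg)] at h1
    rw [ENNReal.ofReal_le_ofReal_iff (hu.deriv_pos _ (by exact_mod_cast hpos)).le] at h2
    rw [abs_of_nonneg (by linarith)]
    have h3 : (h z).toReal ≤ ∑ z, (h z).toReal := Finset.single_le_sum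
      (f := fun z => (h z).toReal) (fun _ _ => ENNReal.toReal_nonneg) (Finset.mem_univ z)
    linarith

theorem IsCandidate.isEulerPolicy (hm : m.IsRegular) (hs : s.IsDriving m.P μ)
    (hd : IsCandidate m d) (h : IsTimeIterate m s μ d d) :
    ∃ M, IsEulerPolicy m s μ d M := by
  obtain ⟨M, hM⟩ := hd.bounded
  refine ⟨ENNReal.ofReal M, hd.measurable, hd.le, ENNReal.ofReal_ne_top, fun a z => ?_,
    fun a z ha => ?_⟩
  · rcases eq_or_lt_of_le (zero_le : 0 ≤ a) with rfl | ha
    · simp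
    · rw [marginal_of_pos ha, marginal_of_pos (hd.pos a z ha)]
      refine le_trans (ENNReal.ofReal_le_ofReal ?_) ENNReal.ofReal_add_le
      have := (abs_le.1 (hM a z ha)).2
      linarith
  · rw [(h a z ha).2.2, eulerRHS_eq hm hs hd.measurable]

theorem IsMonotonePolicy.isTimeIterate (hm : m.IsRegular) (hs : s.IsDriving m.P μ)
    (hh : ∀ z, h z ≠ ⊤) (hc : IsMonotonePolicy m h c) (he : IsEulerIterate m s μ c c) :
    IsTimeIterate m s μ c c := fun a z ha =>
  ⟨(hc.isCandidate hm.utility hh).pos a z ha, hc.le a z, by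
    rw [eulerRHS_eq hm hs hc.measurable]; exact (he a z).2⟩

/-- A fixed point of time iteration among the candidates is the optimal consumption function. -/
theorem isOptimalConsumption_of_isTimeIterate (hm : m.IsRegular) (hs : s.IsDriving m.P μ)
    (hkey : KeyConditions m s μ) (hc : IsCandidate m c) (h : IsTimeIterate m s μ c c) :
    IsOptimalConsumption m s μ c := by
  have opt : ∀ d, IsCandidate m d → IsTimeIterate m s μ d d → IsOptimal m s μ d := by
    intro d hd h
    obtain ⟨M, hM⟩ := hd.isEulerPolicy hm hs h
    exact ⟨⟨hd.measurable, hd.le⟩, fun e he a ha z => (hM.lifetimeValue_le hm hs hkey he ha z).1⟩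
  -- An optimal d attains the value of the Euler policy c at every initial point, and the strict gap
  -- then forces equal first choices there. Uniqueness of fixed points follows because each is
  -- optimal.
  have uniq : ∀ d, IsCandidate m d → IsOptimal m s μ d → d = c := by
    intro d hd h'
    obtain ⟨M, hM⟩ := hc.isEulerPolicy hm hs h
    funext a z
    rcases eq_or_lt_of_le (zero_le : 0 ≤ a) with rfl | ha
    · rw [le_zero_iff.1 (hd.le 0 z), le_zero_iff.1 (hc.le 0 z)]
    · exact ((hM.lifetimeValue_le hm hs hkey h'.1 ha z).2
        (h'.2 c ⟨hc.measurable, hc.le⟩ a ha z)).symm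
  refine ⟨hc, fun d hd => ⟨fun h' => uniq d hd (opt d hd h'), ?_⟩,
    fun d hd => ⟨uniq d hd, ?_⟩⟩
  · rintro rfl; exact h
  · rintro rfl; exact opt _ hc h

theorem SavingsBound.weak (hu : IsUtility m.u) {sbar : ℝ≥0} (h : SavingsBound m s μ sbar) :
    WeakSavingsBound m s μ sbar := fun a z ha =>
  (lintegral_mono fun _ =>
    mul_le_mul_right (hu.strictAnti_marginal.antitone le_self_add) _).trans (h a z ha)

/-- The linear lower bound on consumption is preserved by time iteration. -/
theorem IsEulerIterate.linear_le (hm : m.IsRegular) (hs : s.IsDriving m.P μ) {sbar : ℝ≥0}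
    (hsbar : sbar < 1) (hw : WeakSavingsBound m s μ sbar) (h : IsEulerIterate m s μ c d)
    (hc : ∀ a z, (1 - sbar) * a ≤ c a z) (a : ℝ≥0) (z : S) : (1 - sbar) * a ≤ d a z := by
  by_contra! hlt
  have hu := hm.utility
  have hk : 0 < 1 - sbar := tsub_pos_of_lt hsbar
  have ha : 0 < a := by
    rw [pos_iff_ne_zero]; rintro rfl; simp at hlt
  have h1 := hu.strictAnti_marginal hlt
  have hle : (1 - sbar) * a ≤ a := mul_le_of_le_one_left' tsub_le_self
  -- The condition is used at wealth (1 - s̄)a, the consumption level to be compared with.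
  have h2 := hw ((1 - sbar) * a) z (by positivity)
  have hg : ∀ y, Measurable fun x : E × F × H => (m.discRet y x : ℝ≥0∞) *
      marginal m.u (m.ret y x * sbar * ((1 - sbar) * a) + (1 - sbar) * m.inc y x) := fun y => by
    have e1 := hm.measurable_discRet y
    have e2 := hm.measurable_ret y
    have e3 := hm.measurable_inc y
    exact e1.coe_nnreal_ennreal.mul (hu.measurable_marginal.comp (by fun_prop))
  have e := hs.lintegral_one hm.irreducible hg z
  have h3 : s.nextExp μ m.P z (fun y x => (m.discRet y x : ℝ≥0∞) *
      marginal m.u (m.ret y x * sbar * ((1 - sbar) * a) + (1 - sbar) * m.inc y x)) ≤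
      marginal m.u ((1 - sbar) * a) := by
    rw [← e]
    refine le_of_eq_of_le (lintegral_congr fun ω => ?_) h2
    rw [Model.discRet, ENNReal.coe_mul]; rfl
  -- Consuming less than (1 - s̄)a means saving at least s̄a. The bound on c at next wealth then
  -- gives consumption of at least R̂s̄(1 - s̄)a + (1 - s̄)Ŷ, the argument of u' in the weak
  -- condition.
  have hσ : sbar * a ≤ a - d a z := by
    rw [← NNReal.coe_le_coe, NNReal.coe_sub (h a z).1]
    have h4 : (d a z : ℝ) ≤ (1 - sbar) * a := by
      have := hlt.le
      rw [← NNReal.coe_le_coe, NNReal.coe_mul, NNReal.coe_sub hsbar.le] at this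
      exact_mod_cast this
    push_cast
    linarith
  have h4 : eulerNext m s μ c z (a - d a z) ≤ marginal m.u ((1 - sbar) * a) := by
    refine le_trans (Shocks.nextExp_mono (fun y x => mul_le_mul_right
      (hu.strictAnti_marginal.antitone ?_) _) z) h3
    calc m.ret y x * sbar * ((1 - sbar) * a) + (1 - sbar) * m.inc y x
        = (1 - sbar) * (m.ret y x * (sbar * a) + m.inc y x) := by ring
      _ ≤ (1 - sbar) * (m.ret y x * (a - d a z) + m.inc y x) := by gcongr
      _ ≤ _ := hc _ _
  rw [(h a z).2] at h1
  exact absurd h1 (not_lt.2 (max_le h4 (hu.strictAnti_marginal.antitone hle)))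

end OptimalConsumption

/-! ### Constant relative risk aversion. -/

section CRRA

theorem IsCRRA.marginal_eq {u : ℝ≥0 → EReal} {γ : ℝ} (hγ : 0 < γ) (h : IsCRRA u γ) (x : ℝ≥0) :
    marginal u x = (x : ℝ≥0∞) ^ (-γ) := by
  rcases eq_or_lt_of_le (zero_le : 0 ≤ x) with rfl | hx
  · simp [ENNReal.zero_rpow_of_neg, hγ]
  have hx' : (0 : ℝ) < x := by exact_mod_cast hx
  have hd : deriv (realUtility u) x = (x : ℝ) ^ (-γ) := by
    have he : realUtility u =ᶠ[𝓝 (x : ℝ)]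
        fun t => if γ = 1 then Real.log t else t ^ (1 - γ) / (1 - γ) := by
      filter_upwards [lt_mem_nhds hx'] with t ht
      have := h t.toNNReal (by simpa using ht)
      rw [realUtility, this, EReal.toReal_coe, Real.coe_toNNReal _ ht.le]
    rw [he.deriv_eq]
    by_cases h1 : γ = 1
    · simp only [h1, if_true]
      rw [Real.deriv_log, Real.rpow_neg_one]
    · simp only [h1, if_false]
      have h2 : 1 - γ ≠ 0 := sub_ne_zero.2 (Ne.symm h1)
      have := ((Real.hasDerivAt_rpow_const (p := 1 - γ) (.inl hx'.ne')).div_const (1 - γ)).deriv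
      rw [this, mul_div_cancel_left₀ _ h2]
      congr 1
      ring
  rw [marginal_of_pos hx, hd, ← ENNReal.ofReal_rpow_of_pos hx', ENNReal.ofReal_coe_nnreal]

variable {Ω S E F H : Type*} [MeasurableSpace Ω] [Fintype S] [MeasurableSpace S]
  [MeasurableSingletonClass S] [MeasurableSpace E] [MeasurableSpace F] [MeasurableSpace H]
  {μ : Measure Ω} [IsProbabilityMeasure μ] {m : Model S E F H} {s : Shocks Ω S E F H}

/-- Since u'(R̂s̄a) = R̂^(-γ)s̄^(-γ)a^(-γ), the expectation factors as 𝔼_z β̂R̂^(1-γ) times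
s̄^(-γ)a^(-γ), and by the choice of s̄ the first factor is at most s̄^γ. -/
theorem IsCRRA.savingsBound (hm : m.IsRegular) (hs : s.IsDriving m.P μ) {γ : ℝ} (hγ : 0 < γ)
    (h : IsCRRA m.u γ) {sbar : ℝ≥0} (hsbar : (sbar : ℝ≥0∞) = crraSavingsRate m s μ γ) :
    SavingsBound m s μ sbar := by
  intro a z ha
  have hI : ∫⁻ ω, (betaAt m s 1 ω : ℝ≥0∞) * (returnAt m s 1 ω : ℝ≥0∞) ^ (1 - γ)
      ∂(condLaw s μ z) ≤ (sbar : ℝ≥0∞) ^ γ := by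
    rw [hsbar, crraSavingsRate, ← ENNReal.rpow_mul, one_div, inv_mul_cancel₀ hγ.ne',
      ENNReal.rpow_one]
    exact le_iSup (fun z => ∫⁻ ω, (betaAt m s 1 ω : ℝ≥0∞) *
      (returnAt m s 1 ω : ℝ≥0∞) ^ (1 - γ) ∂(condLaw s μ z)) z
  have mβ : Measurable (betaAt m s 1) := hs.measurable_process hm.measurable_disc 1
  have mR : Measurable (returnAt m s 1) := hs.measurable_process hm.measurable_ret 1
  simp_rw [h.marginal_eq hγ]
  -- For s̄ = 0 marginal utility is ∞ throughout, but then β̂R̂^(1-γ), and with it β̂R̂, vanishes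
  -- almost surely, and 0 · ∞ = 0.
  rcases eq_or_ne sbar 0 with rfl | hs0
  · rw [ENNReal.coe_zero, ENNReal.zero_rpow_of_pos hγ, le_zero_iff,
      lintegral_eq_zero_iff (by fun_prop)] at hI
    refine le_of_eq_of_le ?_ zero_le
    rw [lintegral_congr_ae (g := fun _ => 0), lintegral_zero]
    filter_upwards [hI] with ω hω
    have h0 : (betaAt m s 1 ω : ℝ≥0∞) * returnAt m s 1 ω = 0 := by
      rcases mul_eq_zero.1 hω with h1 | h1
      · rw [h1, zero_mul]
      · rcases ENNReal.rpow_eq_zero_iff.1 h1 with h2 | h2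
        · rw [h2.1, mul_zero]
        · exact absurd h2.1 ENNReal.coe_ne_top
    rw [h0, zero_mul]
  · have hs0' : (sbar : ℝ≥0∞) ≠ 0 := by exact_mod_cast hs0
    have ha' : (a : ℝ≥0∞) ≠ 0 := by exact_mod_cast ha.ne'
    calc _ ≤ ∫⁻ ω, (betaAt m s 1 ω : ℝ≥0∞) * (returnAt m s 1 ω : ℝ≥0∞) ^ (1 - γ) *
          ((sbar : ℝ≥0∞) ^ (-γ) * (a : ℝ≥0∞) ^ (-γ)) ∂(condLaw s μ z) := by
          refine lintegral_mono fun ω => ?_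
          -- Where R̂ = 0 the left integrand is 0 while the right one need not be (0^(1-γ) is 1 or ∞
          -- for γ ≥ 1), so only an inequality is claimed.
          rcases eq_or_ne (returnAt m s 1 ω) 0 with hR | hR
          · simp [hR]
          · have hR' : (returnAt m s 1 ω : ℝ≥0∞) ≠ 0 := by exact_mod_cast hR
            rw [ENNReal.coe_mul, ENNReal.coe_mul,
              ENNReal.mul_rpow_of_ne_zero (mul_ne_zero hR' hs0') ha',
              ENNReal.mul_rpow_of_ne_zero hR' hs0', sub_eq_add_neg,
              ENNReal.rpow_add _ _ hR' ENNReal.coe_ne_top, ENNReal.rpow_one]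
            apply le_of_eq
            ring
      _ = (∫⁻ ω, (betaAt m s 1 ω : ℝ≥0∞) * (returnAt m s 1 ω : ℝ≥0∞) ^ (1 - γ)
          ∂(condLaw s μ z)) * ((sbar : ℝ≥0∞) ^ (-γ) * (a : ℝ≥0∞) ^ (-γ)) :=
          lintegral_mul_const _ (by fun_prop)
      _ ≤ (sbar : ℝ≥0∞) ^ γ * ((sbar : ℝ≥0∞) ^ (-γ) * (a : ℝ≥0∞) ^ (-γ)) := by gcongr
      _ = _ := by
          rw [← mul_assoc, ← ENNReal.rpow_add _ _ hs0' ENNReal.coe_ne_top, add_neg_cancel,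
            ENNReal.rpow_zero, one_mul]

end CRRA
end IncomeFluctuation

theorem mainTheorem10
    {Ω S E F H : Type*} [MeasurableSpace Ω] [Fintype S] [Nonempty S] [MeasurableSpace S]
    [MeasurableSingletonClass S] [MeasurableSpace E] [MeasurableSpace F] [MeasurableSpace H]
    (μ : Measure Ω) [IsProbabilityMeasure μ]
    (m : IncomeFluctuation.Model S E F H) (hm : m.IsRegular)
    (s : IncomeFluctuation.Shocks Ω S E F H) (hs : s.IsDriving m.P μ)
    (hkey : IncomeFluctuation.KeyConditions m s μ) :
    ∃ c : ℝ≥0 → S → ℝ≥0, IncomeFluctuation.IsOptimalConsumption m s μ c ∧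
      (∀ sbar : ℝ≥0, sbar < 1 → IncomeFluctuation.SavingsBound m s μ sbar →
        ∀ (a : ℝ≥0) (z : S), 0 < a → (1 - (sbar : ℝ)) * a ≤ c a z) ∧
      (∀ sbar : ℝ≥0, sbar < 1 → IncomeFluctuation.WeakSavingsBound m s μ sbar →
        ∀ (a : ℝ≥0) (z : S), 0 < a → (1 - (sbar : ℝ)) * a ≤ c a z) ∧
      (∀ γ : ℝ, 0 < γ → IncomeFluctuation.IsCRRA m.u γ →
        ∀ sbar : ℝ≥0, (sbar : ℝ≥0∞) = IncomeFluctuation.crraSavingsRate m s μ γ → sbar < 1 →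
          IncomeFluctuation.SavingsBound m s μ sbar ∧
          ∀ (a : ℝ≥0) (z : S), 0 < a → (1 - (sbar : ℝ)) * a ≤ c a z) := by
  obtain ⟨cn, c, h0, hstep, hlim, hc, hfix⟩ :=
    IncomeFluctuation.exists_isEulerIterate_self hm hs hkey
  have hh := IncomeFluctuation.marginalBound_ne_top hm hs hkey
  have weak : ∀ sbar : ℝ≥0, sbar < 1 → IncomeFluctuation.WeakSavingsBound m s μ sbar →
      ∀ (a : ℝ≥0) (z : S), 0 < a → (1 - (sbar : ℝ)) * a ≤ c a z := by
    intro sbar hsbar hw a z _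
    -- The bound is carried by the iterates rather than derived from the fixed-point equation: it is
    -- trivial for c(a,z) = a and passes to the limit.
    have hn : ∀ n a z, (1 - sbar) * a ≤ cn n a z := by
      intro n
      induction n with
      | zero => exact fun a z => by rw [h0]; exact mul_le_of_le_one_left' tsub_le_self
      | succ n ih => exact (hstep n).linear_le hm hs hsbar hw ih
    have h1 : (1 - sbar) * a ≤ c a z := ge_of_tendsto' (hlim a z) fun n => hn n a z
    rw [← NNReal.coe_le_coe, NNReal.coe_mul, NNReal.coe_sub hsbar.le] at h1
    exact h1
  refine ⟨c, IncomeFluctuation.isOptimalConsumption_of_isTimeIterate hm hs hkey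
    (hc.isCandidate hm.utility hh) (hc.isTimeIterate hm hs hh hfix),
    fun sbar hsbar hS => weak sbar hsbar (hS.weak hm.utility), weak, ?_⟩
  intro γ hγ hu sbar he hsbar
  have hS := hu.savingsBound hm hs hγ he
  exact ⟨hS, weak sbar hsbar (hS.weak hm.utility)⟩
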